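/- Let $M$ be a finite-dimensional smooth manifold with a smooth Riemannian metric $m=\langle\,,\rangle$, and let $G=\{g^\tau\}_{\tau\in\mathbb R}$ be a smooth one-parameter group of isometries of $(M,m)$ whose action generates a smooth principal $G$-bundle $(M,p,\tilde M)$ (so $G$ acts freely, and $p:M\to\tilde M=M/G$ is the quotient map onto a finite-dimensional smooth manifold). For any Riemannian metric $m$ on a manifold $M$, with $p_M:T(M)\to M$ the projection, the Lagrange forms generated by $m$ are the $1$-form $\theta$ and the $2$-form $\sigma=\mathrm d\theta$ on $T(M)$, where $$\theta_w(X)=\langle w,\,Tp_M(X)\rangle,\qquad w\in T(M),\ X\in T_w(T(M)).$$ Let $v(x)=\frac{d}{d\tau}\big|_{\tau=0}g^\tau(x)$ be the generating vector field and $J(w)=\langle v,w\rangle$ the momentum on $T(M)$. For $k\in\mathbb R$ let $J_k=J^{-1}(k)\subset T(M)$, let $\theta^k,\sigma^k$ be the forms induced on $J_k$ by the Lagrange forms $\theta,\sigma$ of $m$, and let $\rho_k:J_k\to T(\tilde M)$ be the restriction of $Tp$. (a) There is a unique smooth Riemannian metric $\tilde m$ on $\tilde M$ (the reduced metric) such that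 $\tilde m(Tp(w_1),Tp(w_2))=\langle w_1,w_2\rangle$ for all $x\in M$ and all $w_1,w_2\in J_0\cap T_x(M)$. (b) There are a unique $1$-form $\tilde\theta^0$ and a unique $2$-form $\tilde\sigma^0$ on $T(\tilde M)$ with $\rho_0^*\tilde\theta^0=\theta^0$ and $\rho_0^*\tilde\sigma^0=\sigma^0$. They are smooth, and they are the Lagrange forms on $T(\tilde M)$ generated by the metric $\tilde m$. (c) For every $k\in\mathbb R$ there is a unique $2$-form $\tilde\sigma^k$ on $T(\tilde M)$ with $\rho_k^*\tilde\sigma^k=\sigma^k$, and $(T(\tilde M),\tilde\sigma^k)$ is a symplectic manifold: $\tilde\sigma^k$ is smooth, closed and non-degenerate. -/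

import Mathlib

open scoped Manifold ContDiff

/-! ### Differential forms on a manifold without boundary -/

section Forms

variable {F : Type*} [NormedAddCommGroup F] [NormedSpace ℝ F]
  {H : Type*} [TopologicalSpace H] (I : ModelWithCorners ℝ F H)
  (N : Type*) [TopologicalSpace N] [ChartedSpace H N]

/-- A (not necessarily smooth) `n`-form on `N`: an alternating `n`-linear form on each tangent
space. Smoothness is the separate predicate `DForm.IsSmooth`. -/
abbrev DForm (n : ℕ) : Type _ := (x : N) → TangentSpace I x [⋀^Fin n]→L[ℝ] ℝ

variable {I N}

/-- The local representative of `η` in the chart around `x₀`: the pull-back of `η` under the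
inverse of the chart. -/
noncomputable def DForm.inChart [I.Boundaryless] {n : ℕ} (η : DForm I N n) (x₀ : N) (y : F) :
    F [⋀^Fin n]→L[ℝ] ℝ :=
  (η ((extChartAt I x₀).symm y)).compContinuousLinearMap
    (mfderiv 𝓘(ℝ, F) I (extChartAt I x₀).symm y)

/-- `η` is a smooth differential form: all its local representatives are smooth. -/
def DForm.IsSmooth [I.Boundaryless] {n : ℕ} (η : DForm I N n) : Prop :=
  ∀ x₀ : N, ContDiffOn ℝ ∞ (η.inChart x₀) (extChartAt I x₀).target

/-- The exterior derivative, computed at `x` in the chart around `x` and carried back to the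
manifold by the chart. The normalization is
`dα (U, V) = U (α V) - V (α U) - α [U, V]` for a `1`-form `α`. -/
noncomputable def DForm.d [I.Boundaryless] {n : ℕ} (η : DForm I N n) : DForm I N (n + 1) :=
  fun x => (extDeriv (η.inChart x) (extChartAt I x x)).compContinuousLinearMap
    (mfderiv I 𝓘(ℝ, F) (extChartAt I x) x)

/-- A symplectic form: a smooth closed non-degenerate `2`-form. -/
structure DForm.IsSymplectic [I.Boundaryless] (η : DForm I N 2) : Prop where
  smooth : η.IsSmooth
  closed : η.d = 0
  nondegenerate : ∀ (x : N) (X : TangentSpace I x),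
    (∀ Y : TangentSpace I x, η x ![X, Y] = 0) → X = 0

/-- The tangent space at `w` of the level set of `f` through `w`, when `f` is regular at `w`:
the kernel of the differential of `f`. -/
noncomputable def levelTangent (I : ModelWithCorners ℝ F H) (f : N → ℝ) (w : N) :
    Submodule ℝ (TangentSpace I w) :=
  LinearMap.ker (mfderiv I 𝓘(ℝ, ℝ) f w).toLinearMap

/-- An `n`-form on the level set `f ⁻¹ {k}` of an everywhere regular function `f`. -/
abbrev LevelForm (I : ModelWithCorners ℝ F H) (f : N → ℝ) (k : ℝ) (n : ℕ) : Type _ :=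
  (w : f ⁻¹' {k}) → levelTangent I f w.1 [⋀^Fin n]→L[ℝ] ℝ

/-- The form induced on the level set `f ⁻¹ {k}` by a form on `N`. -/
noncomputable def DForm.induced {n : ℕ} (η : DForm I N n) (f : N → ℝ) (k : ℝ) :
    LevelForm I f k n :=
  fun w => (η w.1).compContinuousLinearMap (levelTangent I f w.1).subtypeL

/-- The pull-back of a form on `N'` under the restriction of `ρ : N → N'` to the level set
`f ⁻¹ {k}`. -/
noncomputable def DForm.pullbackLevel
    {F' : Type*} [NormedAddCommGroup F'] [NormedSpace ℝ F']
    {H' : Type*} [TopologicalSpace H'] {I' : ModelWithCorners ℝ F' H'}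
    {N' : Type*} [TopologicalSpace N'] [ChartedSpace H' N']
    {n : ℕ} (η : DForm I' N' n) (ρ : N → N') (f : N → ℝ) (k : ℝ) : LevelForm I f k n :=
  fun w => (η (ρ w.1)).compContinuousLinearMap
    ((mfderiv I I' ρ w.1).comp (levelTangent I f w.1).subtypeL)

end Forms

/-! ### Riemannian metrics and their Lagrange forms -/

section Lagrange

variable {E : Type*} [NormedAddCommGroup E] [NormedSpace ℝ E]

/-- Smooth Riemannian metrics on the manifold `M`. -/
abbrev SmoothMetric (E : Type*) [NormedAddCommGroup E] [NormedSpace ℝ E]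
    (M : Type*) [TopologicalSpace M] [ChartedSpace E M] [IsManifold 𝓘(ℝ, E) ∞ M] : Type _ :=
  Bundle.ContMDiffRiemannianMetric 𝓘(ℝ, E) ∞ E (fun x : M => TangentSpace 𝓘(ℝ, E) x)

variable {M : Type*} [TopologicalSpace M] [ChartedSpace E M] [IsManifold 𝓘(ℝ, E) ∞ M]

/-- The Lagrange `1`-form `θ` on `T(M)` generated by the metric `m`:
`θ_w (X) = ⟨w, Tp_M (X)⟩` for `X ∈ T_w (T(M))`, where `p_M : T(M) → M` is the projection. -/
noncomputable def lagrangeForm (m : SmoothMetric E M) :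
    DForm (𝓘(ℝ, E).tangent) (TangentBundle 𝓘(ℝ, E) M) 1 :=
  fun w => ContinuousAlternatingMap.ofSubsingleton ℝ _ ℝ (0 : Fin 1)
    ((m.inner w.proj w.snd).comp
      (mfderiv (𝓘(ℝ, E).tangent) 𝓘(ℝ, E)
        (fun u : TangentBundle 𝓘(ℝ, E) M => u.proj) w))

/-- The Lagrange `2`-form `σ = dθ` on `T(M)` generated by the metric `m`. -/
noncomputable def lagrangeTwoForm (m : SmoothMetric E M) :
    DForm (𝓘(ℝ, E).tangent) (TangentBundle 𝓘(ℝ, E) M) 2 :=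
  (lagrangeForm m).d

end Lagrange

/-! ### One-parameter groups and reduction -/

section Reduction

variable {E : Type*} [NormedAddCommGroup E] [NormedSpace ℝ E]
  {M : Type*} [TopologicalSpace M] [ChartedSpace E M]

/-- A smooth one-parameter group `{g^τ}` of diffeomorphisms of `M`. -/
structure IsOneParameterGroup (E : Type*) [NormedAddCommGroup E] [NormedSpace ℝ E]
    {M : Type*} [TopologicalSpace M] [ChartedSpace E M] (g : ℝ → M → M) : Prop where
  smooth : ContMDiff (𝓘(ℝ, ℝ).prod 𝓘(ℝ, E)) 𝓘(ℝ, E) ∞ (fun z : ℝ × M => g z.1 z.2)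
  zero : ∀ x, g 0 x = x
  add : ∀ s t x, g (s + t) x = g s (g t x)

/-- `(M, p, M')` is a smooth principal bundle whose structure group is the transformation group
`G = {g^τ}`, that is, `G = ℝ / Γ` with `Γ = {τ | g^τ = id}`: `G` acts freely, the fibres of `p`
are its orbits, and over a neighbourhood `U` of each point of `M'` there is a section `s` of `p`
such that the bijection `U × ℝ / Γ → p ⁻¹ (U)`, `(u, τ) ↦ g^τ (s u)`, is a diffeomorphism.
As `ℝ → ℝ / Γ` is a local diffeomorphism, the last condition says that the induced map
`U × ℝ → M` is a local diffeomorphism (which also forces `Γ` to be discrete). -/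
structure IsPrincipalBundle (E E' : Type*) [NormedAddCommGroup E] [NormedSpace ℝ E]
    [NormedAddCommGroup E'] [NormedSpace ℝ E']
    {M : Type*} [TopologicalSpace M] [ChartedSpace E M]
    {M' : Type*} [TopologicalSpace M'] [ChartedSpace E' M']
    (g : ℝ → M → M) (p : M → M') : Prop where
  smooth : ContMDiff 𝓘(ℝ, E) 𝓘(ℝ, E') ∞ p
  surjective : Function.Surjective p
  fibre : ∀ x y, p x = p y ↔ ∃ τ, g τ x = y
  free : ∀ τ x, g τ x = x → ∀ y, g τ y = y
  locallyTrivial : ∀ x' : M', ∃ U : Set M', IsOpen U ∧ x' ∈ U ∧ ∃ s : M' → M,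
    (∀ u ∈ U, p (s u) = u) ∧
    IsLocalDiffeomorphOn (𝓘(ℝ, E').prod 𝓘(ℝ, ℝ)) 𝓘(ℝ, E) ∞
      (fun z : M' × ℝ => g z.2 (s z.1)) (U ×ˢ Set.univ)

/-- The generating vector field `v (x) = d/dτ g^τ (x)` at `τ = 0`
(recall that `g^0 (x) = x`). -/
noncomputable def generator (E : Type*) [NormedAddCommGroup E] [NormedSpace ℝ E]
    {M : Type*} [TopologicalSpace M] [ChartedSpace E M] (g : ℝ → M → M) (x : M) :
    TangentSpace 𝓘(ℝ, E) x :=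
  (mfderiv 𝓘(ℝ, ℝ) 𝓘(ℝ, E) (fun τ : ℝ => g τ x) 0 : ℝ →L[ℝ] E) (1 : ℝ)

variable [IsManifold 𝓘(ℝ, E) ∞ M]

/-- All `g^τ` preserve the metric `m`. -/
def PreservesMetric (m : SmoothMetric E M) (g : ℝ → M → M) : Prop :=
  ∀ (τ : ℝ) (x : M) (a b : TangentSpace 𝓘(ℝ, E) x),
    m.inner (g τ x) (mfderiv 𝓘(ℝ, E) 𝓘(ℝ, E) (g τ) x a)
      (mfderiv 𝓘(ℝ, E) 𝓘(ℝ, E) (g τ) x b) = m.inner x a b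

/-- The momentum `J (w) = ⟨v, w⟩` on `T(M)`. -/
noncomputable def momentum (m : SmoothMetric E M) (g : ℝ → M → M)
    (w : TangentBundle 𝓘(ℝ, E) M) : ℝ :=
  m.inner w.proj (generator E g w.proj) w.snd

/-- `m'` is the reduced metric: `m' (Tp w₁, Tp w₂) = ⟨w₁, w₂⟩` for all `w₁, w₂ ∈ T_x M` with zero
momentum. -/
def IsReducedMetric
    {E' : Type*} [NormedAddCommGroup E'] [NormedSpace ℝ E']
    {M' : Type*} [TopologicalSpace M'] [ChartedSpace E' M'] [IsManifold 𝓘(ℝ, E') ∞ M']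
    (m : SmoothMetric E M) (g : ℝ → M → M) (p : M → M') (m' : SmoothMetric E' M') : Prop :=
  ∀ (x : M) (w₁ w₂ : TangentSpace 𝓘(ℝ, E) x),
    momentum m g ⟨x, w₁⟩ = 0 → momentum m g ⟨x, w₂⟩ = 0 →
    m'.inner (p x) (mfderiv 𝓘(ℝ, E) 𝓘(ℝ, E') p x w₁) (mfderiv 𝓘(ℝ, E) 𝓘(ℝ, E') p x w₂) =
      m.inner x w₁ w₂

/-- The form `η` on `T(M')` is a descent of the form `α` on `T(M)` from the momentum level `J_k`:
the form induced by `α` on `J_k` is the pull-back `ρ_k^* η`, where `ρ_k : J_k → T(M')` is the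
restriction of `Tp`. -/
def DescendsFromLevel
    {E' : Type*} [NormedAddCommGroup E'] [NormedSpace ℝ E']
    {M' : Type*} [TopologicalSpace M'] [ChartedSpace E' M'] [IsManifold 𝓘(ℝ, E') ∞ M']
    (m : SmoothMetric E M) (g : ℝ → M → M) (p : M → M') (k : ℝ) {n : ℕ}
    (α : DForm (𝓘(ℝ, E).tangent) (TangentBundle 𝓘(ℝ, E) M) n)
    (η : DForm (𝓘(ℝ, E').tangent) (TangentBundle 𝓘(ℝ, E') M') n) : Prop :=
  η.pullbackLevel (I := 𝓘(ℝ, E).tangent) (tangentMap 𝓘(ℝ, E) 𝓘(ℝ, E') p) (momentum m g) k =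
    α.induced (momentum m g) k

end Reduction

section

open Filter Topology

/-! Let `v` be the generator, `J` the momentum, `π` the projection of either tangent bundle, and `α
= ⟨v, ·⟩ / ⟨v, v⟩` the connection form of the bundle. Everything follows from splitting the metric
into its horizontal part and its part along `v`. The horizontal part is invariant and has `v` in its
radical, so it descends to the reduced metric. Evaluated on `(w, Tπ X)`, the same splitting reads `θ
= (Tp)^* θ̃ + J · π^* α`, where `θ̃` is the Lagrange form of the reduced metric (`lagrangeForm_eq`).

On `J = 0` the second term vanishes, which settles the `1`-form. On vectors tangent to `J = k` the
term `dJ ∧ π^* α` vanishes, so there `σ = (Tp)^* dθ̃ + k π^* dα`. Although `α` does not descend,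
`dα` does: near a point `y = g^t(y) (s (p y))` for a local section `s`, hence `α = (s ∘ p)^* α +
dt`, and `dα` is the pull-back of a closed form `K` on the base (`exists_curvature`). The reduced
form is therefore `dθ̃ + k π^* K`, a Lagrange form with a magnetic term (`magneticForm_descends`).
The magnetic term is blind to vertical vectors, so non-degeneracy comes from the metric alone.

Uniqueness holds because `Tp`, restricted to a momentum level, is onto and has onto differential:
adding multiples of `v` adjusts `J` freely without changing the image (`exists_mem_level`,
`exists_levelTangent_lift`). -/

theorem exists_clm_leftInverse {V ι : Type*} [NormedAddCommGroup V] [NormedSpace ℝ V] [Finite ι]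
    (T : V → ι → ℝ) (hadd : ∀ x y, T (x + y) = T x + T y) (hsmul : ∀ (c : ℝ) x, T (c • x) = c • T x)
    (hT : Function.Injective T) : ∃ S : (ι → ℝ) →L[ℝ] V, ∀ x, S (T x) = x := by
  have := Fintype.ofFinite ι
  let T' : V →ₗ[ℝ] (ι → ℝ) := { toFun := T, map_add' := hadd, map_smul' := hsmul }
  obtain ⟨S, hS⟩ := T'.exists_leftInverse_of_injective (LinearMap.ker_eq_bot.2 hT)
  exact ⟨S.toContinuousLinearMap, LinearMap.congr_fun hS⟩

/-! ### Smooth families of alternating maps and the exterior derivative on a vector space. -/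

section Alternating

variable {G : Type*} [NormedAddCommGroup G] [NormedSpace ℝ G]
  {F : Type*} [NormedAddCommGroup F] [NormedSpace ℝ F]
  {F' : Type*} [NormedAddCommGroup F'] [NormedSpace ℝ F']

/-- On a finite-dimensional space, a family of alternating maps is smooth as soon as all its
evaluations are. -/
theorem contDiffAt_alternating_of_apply [FiniteDimensional ℝ F] {n : ℕ} {r : WithTop ℕ∞}
    {f : G → F [⋀^Fin n]→L[ℝ] ℝ} {x : G}
    (h : ∀ v, ContDiffAt ℝ r (fun y => f y v) x) : ContDiffAt ℝ r f x := by
  let b := Module.finBasis ℝ F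
  -- An alternating map is recovered from its values on tuples of basis vectors by a continuous
  -- linear map, so smooth coefficients suffice.
  obtain ⟨S, hS⟩ := exists_clm_leftInverse
    (fun (η : F [⋀^Fin n]→L[ℝ] ℝ) (j : Fin n → Fin (Module.finrank ℝ F)) => η (fun i => b (j i)))
    (fun _ _ => rfl) (fun _ _ => rfl) (fun η η' hη => by
      apply ContinuousAlternatingMap.toAlternatingMap_injective
      exact b.ext_alternating fun j _ => congrFun hη j)
  rw [show f = fun y => S _ from funext fun y => (hS (f y)).symm]
  refine S.contDiff.contDiffAt.comp x ?_
  exact contDiffAt_pi.2 fun j => h _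

theorem ContDiffAt.alternating_apply_const {n : ℕ} {r : WithTop ℕ∞}
    {f : G → F [⋀^Fin n]→L[ℝ] ℝ} {x : G} (h : ContDiffAt ℝ r f x) (v : Fin n → F) :
    ContDiffAt ℝ r (fun y => f y v) x :=
  (ContinuousAlternatingMap.apply ℝ F ℝ v).contDiff.contDiffAt.comp x h

theorem ContDiffAt.alternating_apply [FiniteDimensional ℝ F] {n : ℕ} {r : WithTop ℕ∞}
    {f : G → F [⋀^Fin n]→L[ℝ] ℝ} {v : G → Fin n → F} {x : G} (h : ContDiffAt ℝ r f x)
    (hv : ∀ i, ContDiffAt ℝ r (fun y => v y i) x) : ContDiffAt ℝ r (fun y => f y (v y)) x := by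
  let b := Module.finBasis ℝ F
  have key : ∀ y, f y (v y) =
      ∑ j : Fin n → Fin (Module.finrank ℝ F), (∏ i, b.coord (j i) (v y i)) *
        f y (fun i => b (j i)) := by
    intro y
    have h1 : v y = fun i => ∑ k, b.coord k (v y i) • b k := by
      funext i; exact (b.sum_repr (v y i)).symm
    conv_lhs => rw [h1]
    have h2 := (f y).toMultilinearMap.map_sum (fun i k => b.coord k (v y i) • b k)
    refine h2.trans (Finset.sum_congr rfl fun j _ => ?_)
    exact (f y).toMultilinearMap.map_smul_univ (fun i => b.coord (j i) (v y i))
      (fun i => b (j i))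
  simp_rw [key]
  refine ContDiffAt.sum fun j _ => ContDiffAt.mul ?_ (h.alternating_apply_const _)
  refine contDiffAt_prod fun i _ => ?_
  exact (LinearMap.toContinuousLinearMap (b.coord (j i))).contDiff.contDiffAt.comp x (hv i)

theorem ContDiffAt.alternating_comp [FiniteDimensional ℝ F] [FiniteDimensional ℝ F'] {n : ℕ}
    {r : WithTop ℕ∞} {f : G → F' [⋀^Fin n]→L[ℝ] ℝ} {L : G → F →L[ℝ] F'} {x : G}
    (h : ContDiffAt ℝ r f x) (hL : ContDiffAt ℝ r L x) :
    ContDiffAt ℝ r (fun y => (f y).compContinuousLinearMap (L y)) x :=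
  contDiffAt_alternating_of_apply fun v =>
    h.alternating_apply (v := fun y i => L y (v i)) fun _ => hL.clm_apply contDiffAt_const

/-- The exterior derivative of a `1`-form on a vector space. -/
theorem extDeriv_one_apply {η : F → F [⋀^Fin 1]→L[ℝ] ℝ} {x : F} (h : DifferentiableAt ℝ η x)
    (X Y : F) :
    extDeriv η x ![X, Y] =
      fderiv ℝ (fun y => η y ![Y]) x X - fderiv ℝ (fun y => η y ![X]) x Y := by
  rw [extDeriv_apply h, Fin.sum_univ_two]
  have h0 : (0 : Fin 2).removeNth ![X, Y] = ![Y] := by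
    funext i; fin_cases i; rfl
  have h1 : (1 : Fin 2).removeNth ![X, Y] = ![X] := by
    funext i; fin_cases i; rfl
  simp [h0, h1, sub_eq_add_neg]

theorem ContDiffAt.extDeriv {n : ℕ} {η : F → F [⋀^Fin n]→L[ℝ] ℝ} {x : F}
    (h : ContDiffAt ℝ ∞ η x) : ContDiffAt ℝ ∞ (extDeriv η) x := by
  have he : _root_.extDeriv η = fun y =>
      ContinuousAlternatingMap.alternatizeUncurryFinCLM ℝ F ℝ (n := n) (fderiv ℝ η y) := by
    funext y
    simp [_root_.extDeriv]
  rw [he]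
  exact (ContinuousLinearMap.contDiff _).contDiffAt.comp x (h.fderiv_right (m := ∞) le_rfl)

theorem minSmoothness_two_le_infty : minSmoothness ℝ 2 ≤ (∞ : WithTop ℕ∞) := by
  rw [minSmoothness_of_isRCLikeNormedField]
  exact ENat.LEInfty.out

end Alternating

/-! ### Forms on manifolds: charts, pull-backs and naturality of `d`. -/

section FormCalculus

variable {F : Type*} [NormedAddCommGroup F] [NormedSpace ℝ F]
  {H : Type*} [TopologicalSpace H] {I : ModelWithCorners ℝ F H}
  {N : Type*} [TopologicalSpace N] [ChartedSpace H N]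
  {F' : Type*} [NormedAddCommGroup F'] [NormedSpace ℝ F']
  {H' : Type*} [TopologicalSpace H'] {I' : ModelWithCorners ℝ F' H'}
  {N' : Type*} [TopologicalSpace N'] [ChartedSpace H' N']
  {n : ℕ}

/-- The pull-back of a form. -/
noncomputable def DForm.pullback (I : ModelWithCorners ℝ F H) (η : DForm I' N' n) (f : N → N') :
    DForm I N n :=
  fun x => (η (f x)).compContinuousLinearMap (mfderiv I I' f x)

/-- Smoothness of a form at a point. -/
def DForm.SmoothAt [I.Boundaryless] (η : DForm I N n) (x : N) : Prop :=
  ContDiffAt ℝ ∞ (η.inChart x) (extChartAt I x x)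

/-- Fibres over points that are only provably equal are different types; reading all of them as the
model space makes the substitution possible. -/
theorem DForm.apply_congr (η : DForm I N n) {x y : N} (h : x = y) {v w : Fin n → F}
    (hvw : v = w) :
    (show F [⋀^Fin n]→L[ℝ] ℝ from η x) v = (show F [⋀^Fin n]→L[ℝ] ℝ from η y) w := by
  subst h hvw; rfl

section Charts

variable [I.Boundaryless] [I'.Boundaryless]

theorem mdifferentiableAt_extChartAt_symm_of_boundaryless [IsManifold I 1 N] {x₀ : N} {y : F}
    (hy : y ∈ (extChartAt I x₀).target) :
    MDifferentiableAt 𝓘(ℝ, F) I (extChartAt I x₀).symm y := by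
  have := mdifferentiableWithinAt_extChartAt_symm (I := I) hy
  rwa [I.range_eq_univ, mdifferentiableWithinAt_univ] at this

variable [IsManifold I ∞ N] [IsManifold I' ∞ N']

theorem contMDiffAt_extChartAt_symm_of_boundaryless {x₀ : N} {y : F}
    (hy : y ∈ (extChartAt I x₀).target) :
    ContMDiffAt 𝓘(ℝ, F) I ∞ (extChartAt I x₀).symm y := by
  have := contMDiffWithinAt_extChartAt_symm_range (I := I) (n := ∞) x₀ hy
  rwa [I.range_eq_univ, contMDiffWithinAt_univ] at this

omit [I'.Boundaryless] in
/-- The local representative of `f` is smooth. -/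
theorem contDiffAt_localRep {f : N → N'} {x x₀ : N} {y₀ : N'}
    (hf : ContMDiffAt I I' ∞ f x) (hx : x ∈ (extChartAt I x₀).source)
    (hy : f x ∈ (extChartAt I' y₀).source) :
    ContDiffAt ℝ ∞ (extChartAt I' y₀ ∘ f ∘ (extChartAt I x₀).symm) (extChartAt I x₀ x) := by
  rw [← contMDiffAt_iff_contDiffAt]
  have hl := (extChartAt I x₀).left_inv hx
  refine ContMDiffAt.comp (I' := I') _ ?_ (ContMDiffAt.comp (I' := I) _ ?_
    (contMDiffAt_extChartAt_symm_of_boundaryless ((extChartAt I x₀).map_source hx)))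
  · rw [Function.comp_apply, hl]
    exact contMDiffAt_extChartAt' (by rwa [extChartAt_source] at hy)
  · rwa [hl]

/-- Pull-back in charts. -/
theorem DForm.inChart_pullback (η : DForm I' N' n) {f : N → N'} {x x₀ : N} {y₀ : N'}
    (hf : ContMDiffAt I I' ∞ f x) (hx : x ∈ (extChartAt I x₀).source)
    (hy : f x ∈ (extChartAt I' y₀).source) :
    (η.pullback I f).inChart x₀ =ᶠ[nhds (extChartAt I x₀ x)] fun y =>
      (η.inChart y₀ ((extChartAt I' y₀ ∘ f ∘ (extChartAt I x₀).symm) y)).compContinuousLinearMap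
        (fderiv ℝ (extChartAt I' y₀ ∘ f ∘ (extChartAt I x₀).symm) y) := by
  have hl := (extChartAt I x₀).left_inv hx
  have hxt := (extChartAt I x₀).map_source hx
  have hsymm : Filter.Tendsto (extChartAt I x₀).symm (nhds (extChartAt I x₀ x)) (nhds x) := by
    have := (contMDiffAt_extChartAt_symm_of_boundaryless (I := I) hxt).continuousAt
    rwa [ContinuousAt, hl] at this
  have h1 : ∀ᶠ z in nhds x, f z ∈ (extChartAt I' y₀).source :=
    hf.continuousAt.eventually_mem ((isOpen_extChartAt_source y₀).mem_nhds hy)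
  have h2 : ∀ᶠ z in nhds x, ContMDiffAt I I' 1 f z :=
    (contMDiffAt_iff_contMDiffAt_nhds (by simp)).1 (hf.of_le (by simp))
  have h3 : ∀ᶠ y in nhds (extChartAt I x₀ x), y ∈ (extChartAt I x₀).target :=
    (isOpen_extChartAt_target x₀).mem_nhds hxt
  filter_upwards [hsymm.eventually h2, (hsymm.eventually h1).eventually_nhds, h3] with y hy2 hy1 hy3
  have hfy : MDifferentiableAt I I' f ((extChartAt I x₀).symm y) :=
    hy2.mdifferentiableAt (by simp)
  have hsy := mdifferentiableAt_extChartAt_symm_of_boundaryless (I := I) hy3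
  have hy1' := hy1.self_of_nhds
  set fh := extChartAt I' y₀ ∘ f ∘ (extChartAt I x₀).symm with hfh
  have hfhy : MDifferentiableAt 𝓘(ℝ, F) 𝓘(ℝ, F') fh y := by
    refine MDifferentiableAt.comp y (I' := I') ?_ (hfy.comp y hsy)
    exact mdifferentiableAt_extChartAt (by rwa [extChartAt_source] at hy1')
  have hpt : (extChartAt I' y₀).symm (fh y) = f ((extChartAt I x₀).symm y) :=
    (extChartAt I' y₀).left_inv hy1'
  -- The claim is the chain rule applied to two factorizations of one map near `y`.
  have hev : (extChartAt I' y₀).symm ∘ fh =ᶠ[nhds y] f ∘ (extChartAt I x₀).symm := by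
    filter_upwards [hy1] with z hz
    exact (extChartAt I' y₀).left_inv hz
  have hder := hev.mfderiv_eq (I := 𝓘(ℝ, F)) (I' := I')
  rw [mfderiv_comp y (I' := 𝓘(ℝ, F')) (mdifferentiableAt_extChartAt_symm_of_boundaryless
    ((extChartAt I' y₀).map_source hy1')) hfhy, mfderiv_comp y hfy hsy, mfderiv_eq_fderiv] at hder
  ext v
  refine η.apply_congr hpt.symm (funext fun i => ?_)
  exact (DFunLike.congr_fun hder (v i)).symm

/-- `SmoothAt` refers to the preferred chart at the point. The pull-back formula for `id`, with
different charts on the two sides, is the change of charts, and it removes that choice. -/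
theorem DForm.SmoothAt.contDiffAt_inChart [FiniteDimensional ℝ F] {η : DForm I N n} {x x₀ : N}
    (h : η.SmoothAt x) (hx : x ∈ (extChartAt I x₀).source) :
    ContDiffAt ℝ ∞ (η.inChart x₀) (extChartAt I x₀ x) := by
  have hid : η.pullback I id = η := by
    funext z
    ext v
    simp only [DForm.pullback, mfderiv_id]
    rfl
  have h1 := η.inChart_pullback (f := id) (x := x) (x₀ := x₀) (y₀ := x) contMDiffAt_id hx
    (mem_extChartAt_source x)
  have h2 := contDiffAt_localRep (f := id) (x := x) (x₀ := x₀) (y₀ := x) (contMDiffAt_id (I := I))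
    hx (mem_extChartAt_source x)
  rw [hid] at h1
  refine ContDiffAt.congr_of_eventuallyEq ?_ h1
  refine ContDiffAt.alternating_comp (ContDiffAt.comp (g := η.inChart x) _ ?_ h2)
    (h2.fderiv_right (m := ∞) le_rfl)
  simp only [Function.comp_apply, id, (extChartAt I x₀).left_inv hx]
  exact h


theorem DForm.isSmooth_iff_smoothAt [FiniteDimensional ℝ F] {η : DForm I N n} :
    η.IsSmooth ↔ ∀ x, η.SmoothAt x := by
  refine ⟨fun h x => (h x).contDiffAt ((isOpen_extChartAt_target x).mem_nhds
    (mem_extChartAt_target x)), fun h x₀ y hy => ContDiffAt.contDiffWithinAt ?_⟩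
  have := (h ((extChartAt I x₀).symm y)).contDiffAt_inChart ((extChartAt I x₀).map_target hy)
  rwa [(extChartAt I x₀).right_inv hy] at this

theorem DForm.SmoothAt.pullback [FiniteDimensional ℝ F] [FiniteDimensional ℝ F']
    {η : DForm I' N' n} {f : N → N'} {x : N} (h : η.SmoothAt (f x))
    (hf : ContMDiffAt I I' ∞ f x) : (η.pullback I f).SmoothAt x := by
  have h1 := η.inChart_pullback hf (mem_extChartAt_source (I := I) x)
    (mem_extChartAt_source (I := I') (f x))
  have h2 := contDiffAt_localRep hf (mem_extChartAt_source (I := I) x)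
    (mem_extChartAt_source (I := I') (f x))
  refine ContDiffAt.congr_of_eventuallyEq ?_ h1
  refine ContDiffAt.alternating_comp (ContDiffAt.comp (g := η.inChart (f x)) _ ?_ h2)
    (h2.fderiv_right (m := ∞) le_rfl)
  simp only [Function.comp_apply, extChartAt_to_inv]
  exact h

omit [IsManifold I ∞ N] in
theorem DForm.inChart_congr {η η' : DForm I N n} {x : N} (h : ∀ᶠ z in nhds x, η z = η' z) :
    η.inChart x =ᶠ[nhds (extChartAt I x x)] η'.inChart x := by
  have hsymm : Filter.Tendsto (extChartAt I x).symm (nhds (extChartAt I x x)) (nhds x) := by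
    have := continuousAt_extChartAt_symm (I := I) x
    rwa [ContinuousAt, extChartAt_to_inv] at this
  filter_upwards [hsymm.eventually h] with y hy
  simp only [DForm.inChart, hy]

omit [IsManifold I ∞ N] in
theorem DForm.SmoothAt.congr {η η' : DForm I N n} {x : N} (hη : η.SmoothAt x)
    (h : ∀ᶠ z in nhds x, η' z = η z) : η'.SmoothAt x :=
  ContDiffAt.congr_of_eventuallyEq hη (DForm.inChart_congr h)

omit [IsManifold I ∞ N] in
theorem DForm.d_congr {η η' : DForm I N n} {x : N} (h : ∀ᶠ z in nhds x, η z = η' z) : η.d x = η'.d x := by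
  simp only [DForm.d, (DForm.inChart_congr h).extDeriv_eq]

/-- Naturality of `extDeriv` with arbitrary charts on both sides. The case `f = id` makes `DForm.d`
independent of the chart; the preferred charts give `DForm.d_pullback`. -/
theorem DForm.extDeriv_inChart_pullback [FiniteDimensional ℝ F'] {η : DForm I' N' n} {f : N → N'}
    {x x₀ : N} {y₀ : N'} (h : η.SmoothAt (f x)) (hf : ContMDiffAt I I' ∞ f x)
    (hx : x ∈ (extChartAt I x₀).source) (hy : f x ∈ (extChartAt I' y₀).source) (v : Fin (n + 1) → F) :
    extDeriv ((η.pullback I f).inChart x₀) (extChartAt I x₀ x)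
        (fun i => mfderiv I 𝓘(ℝ, F) (extChartAt I x₀) x (v i)) =
      extDeriv (η.inChart y₀) (extChartAt I' y₀ (f x))
        (fun i => mfderiv I' 𝓘(ℝ, F') (extChartAt I' y₀) (f x) (mfderiv I I' f x (v i))) := by
  have h2 := contDiffAt_localRep hf hx hy
  have hl := (extChartAt I x₀).left_inv hx
  have hfx : (extChartAt I' y₀ ∘ f ∘ (extChartAt I x₀).symm) (extChartAt I x₀ x) =
      extChartAt I' y₀ (f x) := congrArg (fun z => extChartAt I' y₀ (f z)) hl
  have hη := h.contDiffAt_inChart hy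
  have hηd : DifferentiableAt ℝ (η.inChart y₀)
      ((extChartAt I' y₀ ∘ f ∘ (extChartAt I x₀).symm) (extChartAt I x₀ x)) := by
    rw [hfx]
    exact hη.differentiableAt (by simp)
  have h3 := extDeriv_pullback hηd h2 minSmoothness_two_le_infty
  rw [(η.inChart_pullback hf hx hy).extDeriv_eq, h3, hfx]
  have hxs : x ∈ (chartAt H x₀).source := by rwa [extChartAt_source] at hx
  have hys : f x ∈ (chartAt H' y₀).source := by rwa [extChartAt_source] at hy
  have hmφ := mdifferentiableAt_extChartAt (I := I) hxs
  have hmψ := mdifferentiableAt_extChartAt (I := I') hys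
  have hmf := hf.mdifferentiableAt (by simp)
  have hev : (extChartAt I' y₀ ∘ f ∘ (extChartAt I x₀).symm) ∘ extChartAt I x₀ =ᶠ[nhds x]
      extChartAt I' y₀ ∘ f := by
    filter_upwards [(isOpen_extChartAt_source x₀).mem_nhds hx] with z hz
    exact congrArg (fun z => extChartAt I' y₀ (f z)) ((extChartAt I x₀).left_inv hz)
  have hder := hev.mfderiv_eq (I := I) (I' := 𝓘(ℝ, F'))
  rw [mfderiv_comp x (I' := 𝓘(ℝ, F)) (h2.differentiableAt (by simp)).mdifferentiableAt hmφ,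
    mfderiv_comp x hmψ hmf, mfderiv_eq_fderiv] at hder
  exact congrArg (fun w : Fin (n + 1) → F' =>
    extDeriv (η.inChart y₀) (extChartAt I' y₀ (f x)) w)
    (funext fun i => DFunLike.congr_fun hder (v i))

theorem DForm.d_apply_chart [FiniteDimensional ℝ F] {η : DForm I N n} {x x₀ : N}
    (h : η.SmoothAt x) (hx : x ∈ (extChartAt I x₀).source) (v : Fin (n + 1) → F) :
    (show F [⋀^Fin (n + 1)]→L[ℝ] ℝ from η.d x) v =
      extDeriv (η.inChart x₀) (extChartAt I x₀ x)
        (fun i => mfderiv I 𝓘(ℝ, F) (extChartAt I x₀) x (v i)) := by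
  have hid : η.pullback I id = η := by
    funext z
    ext v
    simp only [DForm.pullback, mfderiv_id]
    rfl
  have := DForm.extDeriv_inChart_pullback (η := η) (f := id) (x := x) (x₀ := x) (y₀ := x₀)
    h contMDiffAt_id (mem_extChartAt_source x) hx v
  rw [hid, mfderiv_id] at this
  exact this

/-- The exterior derivative commutes with pull-backs. -/
theorem DForm.d_pullback [FiniteDimensional ℝ F'] {η : DForm I' N' n} {f : N → N'} {x : N}
    (h : η.SmoothAt (f x)) (hf : ContMDiffAt I I' ∞ f x) :
    (η.pullback I f).d x = η.d.pullback I f x := by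
  ext v
  exact DForm.extDeriv_inChart_pullback h hf (mem_extChartAt_source x) (mem_extChartAt_source _) v

/-- `DForm.d` changes chart with the point. Chart independence lets one chart serve on its whole
target, which reduces smoothness of `dη` and `d² = 0` to the vector space case. -/
theorem DForm.inChart_d [FiniteDimensional ℝ F] {η : DForm I N n} (h : η.IsSmooth) {x₀ : N} {y : F}
    (hy : y ∈ (extChartAt I x₀).target) : η.d.inChart x₀ y = extDeriv (η.inChart x₀) y := by
  ext v
  have h1 := DForm.d_apply_chart (DForm.isSmooth_iff_smoothAt.1 h ((extChartAt I x₀).symm y))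
    ((extChartAt I x₀).map_target hy) (fun i => mfderiv 𝓘(ℝ, F) I (extChartAt I x₀).symm y (v i))
  refine h1.trans ?_
  rw [(extChartAt I x₀).right_inv hy]
  congr 1
  funext i
  have h2 := mfderiv_extChartAt_comp_mfderivWithin_extChartAt_symm (I := I) hy
  rw [I.range_eq_univ, mfderivWithin_univ] at h2
  exact DFunLike.congr_fun h2 (v i)

theorem DForm.IsSmooth.d [FiniteDimensional ℝ F] {η : DForm I N n} (h : η.IsSmooth) :
    η.d.IsSmooth := fun x₀ y hy => by
  have ht := (isOpen_extChartAt_target (I := I) x₀).mem_nhds hy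
  refine ((((h x₀).contDiffAt ht).extDeriv).congr_of_eventuallyEq ?_).contDiffWithinAt
  filter_upwards [ht] with z hz
  exact DForm.inChart_d h hz

theorem DForm.IsSmooth.d_d [FiniteDimensional ℝ F] {η : DForm I N n} (h : η.IsSmooth) :
    η.d.d = 0 := by
  funext x
  have ht := (isOpen_extChartAt_target (I := I) x).mem_nhds (mem_extChartAt_target x)
  have he : η.d.inChart x =ᶠ[nhds (extChartAt I x x)] extDeriv (η.inChart x) := by
    filter_upwards [ht] with z hz
    exact DForm.inChart_d h hz
  rw [DForm.d, he.extDeriv_eq, extDeriv_extDeriv_apply ((h x).contDiffAt ht) minSmoothness_two_le_infty]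
  rfl

omit [IsManifold I ∞ N] in
theorem DForm.IsSmooth.add_smul {η η' : DForm I N n} (h : η.IsSmooth) (h' : η'.IsSmooth) (c : ℝ) :
    (η + c • η' : DForm I N n).IsSmooth := fun x₀ =>
  (h x₀).add ((h' x₀).const_smul c)

omit [IsManifold I ∞ N] in
theorem DForm.SmoothAt.d_add_smul {η η' : DForm I N n} {x : N} (h : η.SmoothAt x)
    (h' : η'.SmoothAt x) (c : ℝ) :
    (η + c • η' : DForm I N n).d x = η.d x + c • η'.d x := by
  have h1 : (η + c • η' : DForm I N n).inChart x = η.inChart x + c • η'.inChart x := rfl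
  simp only [DForm.d]
  rw [h1, extDeriv_add (h.differentiableAt (by simp))
    ((h'.differentiableAt (by simp)).const_smul c), extDeriv_smul]
  rfl

/-- On vectors annihilated by `df`, `d (f • β) = f • dβ`. -/
theorem DForm.d_smul_apply_of_ker {β : DForm I N 1} {f : N → ℝ} {x : N} (hβ : β.SmoothAt x)
    (hf : ContMDiffAt I 𝓘(ℝ, ℝ) ∞ f x) {X Y : TangentSpace I x}
    (hX : mfderiv I 𝓘(ℝ, ℝ) f x X = 0) (hY : mfderiv I 𝓘(ℝ, ℝ) f x Y = 0) :
    DForm.d (fun z => f z • β z) x ![X, Y] = f x * β.d x ![X, Y] := by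
  set φ := extChartAt I x with hφ
  have hfs : ContMDiffAt 𝓘(ℝ, F) 𝓘(ℝ, ℝ) ∞ (f ∘ φ.symm) (φ x) := by
    refine ContMDiffAt.comp (I' := I) _ ?_
      (contMDiffAt_extChartAt_symm_of_boundaryless (mem_extChartAt_target x))
    rwa [hφ, extChartAt_to_inv]
  have hfd : DifferentiableAt ℝ (f ∘ φ.symm) (φ x) := hfs.contDiffAt.differentiableAt (by simp)
  have hβd : DifferentiableAt ℝ (β.inChart x) (φ x) := hβ.differentiableAt (by simp)
  have hker : ∀ Z : TangentSpace I x, mfderiv I 𝓘(ℝ, ℝ) f x Z = 0 →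
      fderiv ℝ (f ∘ φ.symm) (φ x) (mfderiv I 𝓘(ℝ, F) φ x Z) = 0 := by
    intro Z hZ
    have hev : (f ∘ φ.symm) ∘ φ =ᶠ[nhds x] f := by
      filter_upwards [(isOpen_extChartAt_source (I := I) x).mem_nhds (mem_extChartAt_source x)]
        with z hz
      exact congrArg f ((extChartAt I x).left_inv hz)
    have hder := hev.mfderiv_eq (I := I) (I' := 𝓘(ℝ, ℝ))
    rw [mfderiv_comp x (I' := 𝓘(ℝ, F)) hfd.mdifferentiableAt
      (mdifferentiableAt_extChartAt (mem_chart_source H x)), mfderiv_eq_fderiv] at hder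
    exact (DFunLike.congr_fun hder Z).trans hZ
  have hin : DForm.inChart (fun z => f z • β z : DForm I N 1) x =
      fun y => (f ∘ φ.symm) y • β.inChart x y := rfl
  have hvec : (fun i => mfderiv I 𝓘(ℝ, F) φ x (![X, Y] i)) =
      ![mfderiv I 𝓘(ℝ, F) φ x X, mfderiv I 𝓘(ℝ, F) φ x Y] := by
    funext i; fin_cases i <;> rfl
  change extDeriv (DForm.inChart (fun z => f z • β z : DForm I N 1) x) (φ x)
      (fun i => mfderiv I 𝓘(ℝ, F) φ x (![X, Y] i)) =
    f x * extDeriv (β.inChart x) (φ x) (fun i => mfderiv I 𝓘(ℝ, F) φ x (![X, Y] i))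
  have hfx : (f ∘ φ.symm) (φ x) = f x := by simp [φ]
  -- In the Leibniz rule the term carrying the derivative of `f` drops out along `W`.
  have hd : ∀ V W, fderiv ℝ (f ∘ φ.symm) (φ x) W = 0 →
      fderiv ℝ (fun y => ((f ∘ φ.symm) y • β.inChart x y) ![V]) (φ x) W =
      f x * fderiv ℝ (fun y => β.inChart x y ![V]) (φ x) W := by
    intro V W hW
    have hb : DifferentiableAt ℝ (fun y => β.inChart x y ![V]) (φ x) :=
      ((ContinuousAlternatingMap.apply ℝ F ℝ ![V]).differentiableAt).comp _ hβd
    have : (fun y => ((f ∘ φ.symm) y • β.inChart x y) ![V]) =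
      fun y => (f ∘ φ.symm) y * β.inChart x y ![V] := rfl
    rw [this, fderiv_fun_mul hfd hb, hfx]
    simp [hW]
  have hXc := hker X hX
  have hYc := hker Y hY
  rw [hvec, hin]
  generalize (mfderiv I 𝓘(ℝ, F) φ x X : F) = V at hXc ⊢
  generalize (mfderiv I 𝓘(ℝ, F) φ x Y : F) = W at hYc ⊢
  refine (extDeriv_one_apply (η := fun y => (f ∘ φ.symm) y • β.inChart x y) (x := φ x)
    (hfd.smul hβd) V W).trans (Eq.trans ?_ (congrArg (f x * ·) (extDeriv_one_apply hβd V W).symm))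
  rw [hd W V hXc, hd V W hYc]
  ring

end Charts

end FormCalculus

/-! ### Smoothness of tangent maps. -/

section TangentCalculus

variable {F : Type*} [NormedAddCommGroup F] [NormedSpace ℝ F]
  {H : Type*} [TopologicalSpace H] {I : ModelWithCorners ℝ F H}
  {N : Type*} [TopologicalSpace N] [ChartedSpace H N] [IsManifold I ∞ N]
  {F' : Type*} [NormedAddCommGroup F'] [NormedSpace ℝ F']
  {H' : Type*} [TopologicalSpace H'] {I' : ModelWithCorners ℝ F' H'}
  {N' : Type*} [TopologicalSpace N'] [ChartedSpace H' N'] [IsManifold I' ∞ N']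
  {F'' : Type*} [NormedAddCommGroup F''] [NormedSpace ℝ F'']
  {H'' : Type*} [TopologicalSpace H''] {I'' : ModelWithCorners ℝ F'' H''}
  {P : Type*} [TopologicalSpace P] [ChartedSpace H'' P] [IsManifold I'' ∞ P]

omit [IsManifold I'' ∞ P] in
/-- The image under `Tf` of a smooth family of tangent vectors is smooth. -/
theorem contMDiffAt_mfderiv_apply [IsManifold I'' ∞ P] {f : N → N'} {b : P → N}
    {v : ∀ z, TangentSpace I (b z)} {z₀ : P}
    (hf : ContMDiffAt I I' ∞ f (b z₀))
    (hv : ContMDiffAt I'' I.tangent ∞ (fun z => (⟨b z, v z⟩ : TangentBundle I N)) z₀) :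
    ContMDiffAt I'' I'.tangent ∞
      (fun z => (⟨f (b z), mfderiv I I' f (b z) (v z)⟩ : TangentBundle I' N')) z₀ := by
  have hb : ContMDiffAt I'' I ∞ b z₀ := (Bundle.contMDiffAt_totalSpace.1 hv).1
  have h1 := ContMDiffAt.mfderiv (I := I) (I' := I') (m := ∞) (n := ∞) (fun _ : P => f) b
    (x₀ := z₀) (ContMDiffAt.comp (z₀, b z₀) (g := f) hf contMDiffAt_snd) hb le_rfl
  exact ContMDiffAt.clm_apply_of_inCoordinates (b₁ := b) (b₂ := fun z => f (b z))
    (ϕ := fun z => mfderiv I I' f (b z)) h1 hv (hf.comp z₀ hb)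

theorem ContMDiffAt.tangentMap_infty {f : N → N'} {w : TangentBundle I N}
    (hf : ContMDiffAt I I' ∞ f w.proj) :
    ContMDiffAt I.tangent I'.tangent ∞ (tangentMap I I' f) w :=
  contMDiffAt_mfderiv_apply (P := TangentBundle I N) (b := fun w => w.proj) (v := fun w => w.snd)
    hf contMDiffAt_id

end TangentCalculus

/-! ### Smoothness of metrics, and coordinates on the tangent bundle. -/

section Metric

variable {E : Type*} [NormedAddCommGroup E] [NormedSpace ℝ E]
  {M : Type*} [TopologicalSpace M] [ChartedSpace E M] [IsManifold 𝓘(ℝ, E) ∞ M]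
  {F'' : Type*} [NormedAddCommGroup F''] [NormedSpace ℝ F'']
  {H'' : Type*} [TopologicalSpace H''] {I'' : ModelWithCorners ℝ F'' H''}
  {P : Type*} [TopologicalSpace P] [ChartedSpace H'' P]

theorem SmoothMetric.contMDiffAt_inner (m : SmoothMetric E M) {b : P → M}
    {v w : ∀ z, TangentSpace 𝓘(ℝ, E) (b z)} {z₀ : P}
    (hv : ContMDiffAt I'' (𝓘(ℝ, E).tangent) ∞
      (fun z => (⟨b z, v z⟩ : TangentBundle 𝓘(ℝ, E) M)) z₀)
    (hw : ContMDiffAt I'' (𝓘(ℝ, E).tangent) ∞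
      (fun z => (⟨b z, w z⟩ : TangentBundle 𝓘(ℝ, E) M)) z₀) :
    ContMDiffAt I'' 𝓘(ℝ, ℝ) ∞ (fun z => m.inner (b z) (v z) (w z)) z₀ := by
  have hb : ContMDiffAt I'' 𝓘(ℝ, E) ∞ b z₀ := (Bundle.contMDiffAt_totalSpace.1 hv).1
  have : ContMDiffAt I'' (𝓘(ℝ, E).prod 𝓘(ℝ, ℝ)) ∞
      (fun z => Bundle.TotalSpace.mk' ℝ (E := Bundle.Trivial M ℝ) (b z)
        (m.inner (b z) (v z) (w z))) z₀ := by
    apply ContMDiffAt.clm_bundle_apply₂ (F₁ := E) (F₂ := E)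
    · exact ContMDiffAt.comp z₀ m.contMDiff.contMDiffAt hb
    · exact hv
    · exact hw
  exact (Bundle.contMDiffAt_totalSpace.1 this).2

/-- A fibrewise bilinear form that is smooth on smooth families of vectors is a smooth section. -/
theorem contMDiffAt_bilin_of_apply [FiniteDimensional ℝ E]
    {B : ∀ x : M, TangentSpace 𝓘(ℝ, E) x →L[ℝ] TangentSpace 𝓘(ℝ, E) x →L[ℝ] ℝ} {x₀ : M}
    (h : ∀ v w : ∀ x : M, TangentSpace 𝓘(ℝ, E) x,
      ContMDiffAt 𝓘(ℝ, E) 𝓘(ℝ, E).tangent ∞ (fun x => (⟨x, v x⟩ : TangentBundle 𝓘(ℝ, E) M)) x₀ →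
      ContMDiffAt 𝓘(ℝ, E) 𝓘(ℝ, E).tangent ∞ (fun x => (⟨x, w x⟩ : TangentBundle 𝓘(ℝ, E) M)) x₀ →
      ContMDiffAt 𝓘(ℝ, E) 𝓘(ℝ, ℝ) ∞ (fun x => B x (v x) (w x)) x₀) :
    ContMDiffAt 𝓘(ℝ, E) (𝓘(ℝ, E).prod 𝓘(ℝ, E →L[ℝ] E →L[ℝ] ℝ)) ∞
      (fun x => Bundle.TotalSpace.mk' (E →L[ℝ] E →L[ℝ] ℝ)
        (E := fun x : M => TangentSpace 𝓘(ℝ, E) x →L[ℝ] TangentSpace 𝓘(ℝ, E) x →L[ℝ] ℝ)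
        x (B x)) x₀ := by
  -- Vectors that are constant in the trivialization at `x₀` form smooth local sections; testing on
  -- them reads off the coefficients of `B`.
  have hsec : ∀ a : E, ContMDiffAt 𝓘(ℝ, E) 𝓘(ℝ, E).tangent ∞ (fun x =>
      (⟨x, (trivializationAt E (TangentSpace 𝓘(ℝ, E)) x₀).symm x a⟩ :
        TangentBundle 𝓘(ℝ, E) M)) x₀ := by
    intro a
    refine Bundle.contMDiffAt_totalSpace.2 ⟨contMDiffAt_id, ?_⟩
    refine (contMDiffAt_const (c := a)).congr_of_eventuallyEq ?_
    filter_upwards [(trivializationAt E (TangentSpace 𝓘(ℝ, E)) x₀).open_baseSet.mem_nhds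
      (FiberBundle.mem_baseSet_trivializationAt' x₀)] with x hx
    exact congrArg Prod.snd
      ((trivializationAt E (TangentSpace 𝓘(ℝ, E)) x₀).apply_mk_symm hx a)
  refine (contMDiffAt_hom_bundle _).2 ⟨contMDiffAt_id, ?_⟩
  let b := Module.finBasis ℝ E
  obtain ⟨S, hS⟩ := exists_clm_leftInverse
    (fun (β : E →L[ℝ] E →L[ℝ] ℝ) (i : Fin (Module.finrank ℝ E) × Fin (Module.finrank ℝ E)) =>
      β (b i.1) (b i.2)) (fun _ _ => rfl) (fun _ _ => rfl) (fun β β' hβ =>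
      ContinuousLinearMap.coe_injective (b.ext fun i =>
        ContinuousLinearMap.coe_injective (b.ext fun j => congrFun hβ (i, j))))
  have hcomp : ∀ f : M → E →L[ℝ] E →L[ℝ] ℝ,
      (∀ a c, ContMDiffAt 𝓘(ℝ, E) 𝓘(ℝ, ℝ) ∞ (fun x => f x a c) x₀) →
      ContMDiffAt 𝓘(ℝ, E) 𝓘(ℝ, E →L[ℝ] E →L[ℝ] ℝ) ∞ f x₀ := by
    intro f hf
    rw [show f = fun y => S _ from funext fun y => (hS (f y)).symm]
    refine S.contMDiff.contMDiffAt.comp x₀ ?_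
    exact contMDiffAt_pi_space.2 fun i => hf _ _
  refine hcomp _ fun a c => (h _ _ (hsec a) (hsec c)).congr_of_eventuallyEq ?_
  filter_upwards [(trivializationAt E (TangentSpace 𝓘(ℝ, E)) x₀).open_baseSet.mem_nhds
    (FiberBundle.mem_baseSet_trivializationAt' x₀)] with x hx
  refine (inCoordinates_apply_eq₂ (E₃ := Bundle.Trivial M ℝ) hx hx (Set.mem_univ x)).trans ?_
  simp

/-- A coordinate change from a chart to itself is the identity. This makes derivatives along a fibre
explicit in the model space. -/
theorem trivializationAt_tangentBundle_self (x : M) (b : TangentSpace 𝓘(ℝ, E) x) :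
    (trivializationAt E (TangentSpace 𝓘(ℝ, E)) x ⟨x, b⟩).2 = b :=
  (tangentBundleCore 𝓘(ℝ, E) M).coordChange_self (achart E x) x (mem_chart_source E x) b

/-- The inclusion of a fibre into the tangent bundle has derivative `inr`. -/
theorem hasMFDerivAt_fibreInclusion (x : M) (b₀ : E) :
    HasMFDerivAt 𝓘(ℝ, E) 𝓘(ℝ, E).tangent
      (fun b : E => (⟨x, b⟩ : TangentBundle 𝓘(ℝ, E) M)) b₀
      (ContinuousLinearMap.inr ℝ E E) := by
  have hc : ContMDiffAt 𝓘(ℝ, E) 𝓘(ℝ, E).tangent ∞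
      (fun b : E => (⟨x, b⟩ : TangentBundle 𝓘(ℝ, E) M)) b₀ := by
    refine Bundle.contMDiffAt_totalSpace.2 ⟨contMDiffAt_const, ?_⟩
    exact contMDiffAt_id.congr_of_eventuallyEq
      (Filter.Eventually.of_forall fun b => trivializationAt_tangentBundle_self x b)
  refine ⟨hc.continuousAt, ?_⟩
  have : writtenInExtChartAt 𝓘(ℝ, E) 𝓘(ℝ, E).tangent b₀
      (fun b : E => (⟨x, b⟩ : TangentBundle 𝓘(ℝ, E) M)) =
      fun b => (extChartAt 𝓘(ℝ, E) x x, b) := by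
    funext b
    exact Prod.ext rfl (trivializationAt_tangentBundle_self x b)
  rw [this]
  exact (hasFDerivAt_prodMk_right _ _).hasFDerivWithinAt

theorem hasMFDerivAt_tangentBundle_proj (w : TangentBundle 𝓘(ℝ, E) M) :
    HasMFDerivAt 𝓘(ℝ, E).tangent 𝓘(ℝ, E) (fun u : TangentBundle 𝓘(ℝ, E) M => u.proj) w
      (ContinuousLinearMap.fst ℝ E E) := by
  refine ⟨(FiberBundle.continuous_proj E _).continuousAt, ?_⟩
  have h0 : HasFDerivWithinAt (Prod.fst : E × E → E) (ContinuousLinearMap.fst ℝ E E)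
      (Set.range 𝓘(ℝ, E).tangent) (extChartAt 𝓘(ℝ, E).tangent w w) :=
    (ContinuousLinearMap.fst ℝ E E).hasFDerivAt.hasFDerivWithinAt
  refine HasFDerivWithinAt.congr_of_eventuallyEq h0 ?_ ?_
  · filter_upwards [nhdsWithin_le_nhds (extChartAt_target_mem_nhds (I := 𝓘(ℝ, E).tangent) w)]
      with q hq
    have hq1 : q.1 ∈ (extChartAt 𝓘(ℝ, E) w.proj).target := by
      have := hq
      simp only [mfld_simps] at this ⊢
      exact (TangentBundle.mem_chart_target_iff (I := 𝓘(ℝ, E)) q w).1 this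
    exact (extChartAt 𝓘(ℝ, E) w.proj).right_inv hq1
  · have := mem_extChartAt_target (I := 𝓘(ℝ, E)) w.proj
    exact (extChartAt 𝓘(ℝ, E) w.proj).right_inv this

end Metric

/-! ### Coordinate vector fields as test vectors for `1`-forms. -/

section ChartField

variable {F : Type*} [NormedAddCommGroup F] [NormedSpace ℝ F]
  {H : Type*} [TopologicalSpace H] {I : ModelWithCorners ℝ F H} [I.Boundaryless]
  {N : Type*} [TopologicalSpace N] [ChartedSpace H N] [IsManifold I ∞ N]

/-- The coordinate vector fields of a chart are smooth. -/
theorem contMDiffAt_coordinateField (x : N) (Z : F) :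
    ContMDiffAt 𝓘(ℝ, F) I.tangent ∞ (fun y : F => (⟨(extChartAt I x).symm y,
      mfderiv 𝓘(ℝ, F) I (extChartAt I x).symm y Z⟩ : TangentBundle I N)) (extChartAt I x x) := by
  refine contMDiffAt_mfderiv_apply (b := fun y : F => y) (v := fun y : F => (Z : F))
    (contMDiffAt_extChartAt_symm_of_boundaryless (mem_extChartAt_target x)) ?_
  exact contMDiffAt_vectorSpace_iff_contDiffAt.2 contDiffAt_const

omit [IsManifold I ∞ N] in
theorem DForm.smoothAt_one_of_apply [FiniteDimensional ℝ F] {η : DForm I N 1} {x : N}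
    (h : ∀ Z : F, ContDiffAt ℝ ∞ (fun y : F => η ((extChartAt I x).symm y)
      ![mfderiv 𝓘(ℝ, F) I (extChartAt I x).symm y Z]) (extChartAt I x x)) : η.SmoothAt x := by
  refine contDiffAt_alternating_of_apply fun v => (h (v 0)).congr_of_eventuallyEq ?_
  refine Filter.Eventually.of_forall fun y => η.apply_congr rfl (funext fun i => ?_)
  fin_cases i
  rfl

end ChartField

/-! ### The Lagrange forms in bundle charts. -/

section Lagrange

variable {E : Type*} [NormedAddCommGroup E] [NormedSpace ℝ E]
  {M : Type*} [TopologicalSpace M] [ChartedSpace E M] [IsManifold 𝓘(ℝ, E) ∞ M]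

theorem mfderiv_tangentBundle_proj (w : TangentBundle 𝓘(ℝ, E) M) :
    mfderiv 𝓘(ℝ, E).tangent 𝓘(ℝ, E) (fun u : TangentBundle 𝓘(ℝ, E) M => u.proj) w =
      ContinuousLinearMap.fst ℝ E E :=
  (hasMFDerivAt_tangentBundle_proj w).mfderiv

theorem contMDiff_tangentBundle_proj :
    ContMDiff 𝓘(ℝ, E).tangent 𝓘(ℝ, E) ∞ (fun u : TangentBundle 𝓘(ℝ, E) M => u.proj) :=
  Bundle.contMDiff_proj (TangentSpace 𝓘(ℝ, E))

theorem lagrangeForm_isSmooth [FiniteDimensional ℝ E] (m : SmoothMetric E M) :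
    (lagrangeForm m).IsSmooth := by
  refine DForm.isSmooth_iff_smoothAt.2 fun w => DForm.smoothAt_one_of_apply fun Z => ?_
  rw [← contMDiffAt_iff_contDiffAt]
  refine m.contMDiffAt_inner
    (b := fun q => ((extChartAt 𝓘(ℝ, E).tangent w).symm q).proj)
    (v := fun q => ((extChartAt 𝓘(ℝ, E).tangent w).symm q).snd)
    (w := fun q => mfderiv 𝓘(ℝ, E).tangent 𝓘(ℝ, E)
      (fun u : TangentBundle 𝓘(ℝ, E) M => u.proj) ((extChartAt 𝓘(ℝ, E).tangent w).symm q)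
      (mfderiv 𝓘(ℝ, E × E) 𝓘(ℝ, E).tangent (extChartAt 𝓘(ℝ, E).tangent w).symm q Z)) ?_ ?_
  · exact contMDiffAt_extChartAt_symm_of_boundaryless (mem_extChartAt_target w)
  · exact contMDiffAt_mfderiv_apply contMDiff_tangentBundle_proj.contMDiffAt
      (contMDiffAt_coordinateField w Z)

theorem extChartAt_tangentBundle_symm_self (x : M) (a c : E) :
    (extChartAt 𝓘(ℝ, E).tangent (⟨x, a⟩ : TangentBundle 𝓘(ℝ, E) M)).symm
      (extChartAt 𝓘(ℝ, E) x x, c) = ⟨x, c⟩ := by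
  have h1 : extChartAt 𝓘(ℝ, E).tangent (⟨x, a⟩ : TangentBundle 𝓘(ℝ, E) M) ⟨x, c⟩ =
      (extChartAt 𝓘(ℝ, E) x x, c) :=
    Prod.ext rfl (trivializationAt_tangentBundle_self x c)
  rw [← h1]
  refine (extChartAt 𝓘(ℝ, E).tangent (⟨x, a⟩ : TangentBundle 𝓘(ℝ, E) M)).left_inv ?_
  rw [extChartAt_source]
  exact (TangentBundle.mem_chart_source_iff (I := 𝓘(ℝ, E)) _ _).2 (mem_chart_source E x)

theorem mfderiv_proj_extChartAt_symm (w : TangentBundle 𝓘(ℝ, E) M) {q : E × E}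
    (hq : q ∈ (extChartAt 𝓘(ℝ, E).tangent w).target) (Z : E × E) :
    mfderiv 𝓘(ℝ, E).tangent 𝓘(ℝ, E) (fun u : TangentBundle 𝓘(ℝ, E) M => u.proj)
      ((extChartAt 𝓘(ℝ, E).tangent w).symm q)
      (mfderiv 𝓘(ℝ, E × E) 𝓘(ℝ, E).tangent (extChartAt 𝓘(ℝ, E).tangent w).symm q Z) =
    mfderiv 𝓘(ℝ, E) 𝓘(ℝ, E) (extChartAt 𝓘(ℝ, E) w.proj).symm q.1 Z.1 := by
  have hq1 : q.1 ∈ (extChartAt 𝓘(ℝ, E) w.proj).target := by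
    simp only [mfld_simps] at hq ⊢
    exact (TangentBundle.mem_chart_target_iff (I := 𝓘(ℝ, E)) q w).1 hq
  have h1 := mfderiv_comp q (hasMFDerivAt_tangentBundle_proj
      ((extChartAt 𝓘(ℝ, E).tangent w).symm q)).mdifferentiableAt
    (mdifferentiableAt_extChartAt_symm_of_boundaryless hq)
  have h2 := mfderiv_comp (I := 𝓘(ℝ, E × E)) (I' := 𝓘(ℝ, E)) (I'' := 𝓘(ℝ, E)) q
    (g := (extChartAt 𝓘(ℝ, E) w.proj).symm) (f := Prod.fst)
    (mdifferentiableAt_extChartAt_symm_of_boundaryless hq1)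
    (differentiableAt_fst.mdifferentiableAt)
  have h3 : (fun u : TangentBundle 𝓘(ℝ, E) M => u.proj) ∘ (extChartAt 𝓘(ℝ, E).tangent w).symm =
    (extChartAt 𝓘(ℝ, E) w.proj).symm ∘ Prod.fst := rfl
  rw [h3, h2, mfderiv_eq_fderiv, fderiv_fst] at h1
  exact (DFunLike.congr_fun h1 Z).symm

/-- The metric at a point as a bilinear form on the model space. -/
def SmoothMetric.bilin (m : SmoothMetric E M) (x : M) : E →L[ℝ] E →L[ℝ] ℝ := m.inner x

theorem lagrangeForm_inChart (m : SmoothMetric E M) (w : TangentBundle 𝓘(ℝ, E) M) {q : E × E}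
    (hq : q ∈ (extChartAt 𝓘(ℝ, E).tangent w).target) (Z : E × E) :
    (lagrangeForm m).inChart w q ![Z] =
      m.bilin ((extChartAt 𝓘(ℝ, E).tangent w).symm q).proj
        ((extChartAt 𝓘(ℝ, E).tangent w).symm q).snd
        ((mfderiv 𝓘(ℝ, E) 𝓘(ℝ, E) (extChartAt 𝓘(ℝ, E) w.proj).symm q.1 : E →L[ℝ] E) Z.1) :=
  congrArg (m.bilin ((extChartAt 𝓘(ℝ, E).tangent w).symm q).proj
    ((extChartAt 𝓘(ℝ, E).tangent w).symm q).snd) (mfderiv_proj_extChartAt_symm w hq Z)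

/-- Over its centre the chart acts as the identity on fibres, so the coefficient is linear in the
fibre coordinate `c` and its vertical derivative can be read off. -/
theorem lagrangeForm_inChart_fibre (m : SmoothMetric E M) (x : M) (a c : E) (Z : E × E) :
    (lagrangeForm m).inChart (⟨x, a⟩ : TangentBundle 𝓘(ℝ, E) M)
      ((extChartAt 𝓘(ℝ, E) x x, c) : E × E) ![Z] = m.bilin x c Z.1 := by
  have hct : ((extChartAt 𝓘(ℝ, E) x x, c) : E × E) ∈
      (extChartAt 𝓘(ℝ, E).tangent (⟨x, a⟩ : TangentBundle 𝓘(ℝ, E) M)).target := by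
    simp only [mfld_simps]
    exact (TangentBundle.mem_chart_target_iff (I := 𝓘(ℝ, E)) _ _).2 (mem_chart_target E x)
  have hid := mfderivWithin_range_extChartAt_symm (I := 𝓘(ℝ, E)) (x := x)
  rw [ModelWithCorners.range_eq_univ, mfderivWithin_univ] at hid
  refine (lagrangeForm_inChart m _ hct Z).trans ?_
  rw [extChartAt_tangentBundle_symm_self x a c]
  exact congrArg (m.bilin x c) (DFunLike.congr_fun hid Z.1)

/-- The Lagrange `2`-form paired with a vertical vector. -/
theorem lagrangeTwoForm_vertical [FiniteDimensional ℝ E] (m : SmoothMetric E M)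
    (x : M) (a : E) (X : E × E) (b : E) :
    (show (E × E) [⋀^Fin 2]→L[ℝ] ℝ from
      lagrangeTwoForm m (⟨x, a⟩ : TangentBundle 𝓘(ℝ, E) M)) ![X, (0, b)] = - m.bilin x b X.1 := by
  set w : TangentBundle 𝓘(ℝ, E) M := ⟨x, a⟩ with hw
  have hΦ : extChartAt 𝓘(ℝ, E).tangent w w = (extChartAt 𝓘(ℝ, E) x x, a) :=
    Prod.ext rfl (trivializationAt_tangentBundle_self x a)
  have hd : DifferentiableAt ℝ ((lagrangeForm m).inChart w) (extChartAt 𝓘(ℝ, E).tangent w w) :=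
    (DForm.isSmooth_iff_smoothAt.1 (lagrangeForm_isSmooth m) w).differentiableAt (by simp)
  have hvec : (fun i => mfderiv 𝓘(ℝ, E).tangent 𝓘(ℝ, E × E) (extChartAt 𝓘(ℝ, E).tangent w) w
      ((![X, (0, b)] : Fin 2 → E × E) i)) = ![X, (0, b)] := by
    funext i
    exact DFunLike.congr_fun (mfderiv_extChartAt_self (I := 𝓘(ℝ, E).tangent) (x := w)) _
  have ht := extChartAt_target_mem_nhds (I := 𝓘(ℝ, E).tangent) w
  refine (congrArg (fun v : Fin 2 → E × E => extDeriv ((lagrangeForm m).inChart w)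
    (extChartAt 𝓘(ℝ, E).tangent w w) v) hvec).trans ?_
  refine (extDeriv_one_apply hd X (0, b)).trans ?_
  -- The projection kills the constant field `(0, b)`, so one of the two terms of `dθ` is zero.
  have h0 : (fun q => (lagrangeForm m).inChart w q ![((0, b) : E × E)]) =ᶠ[nhds
      (extChartAt 𝓘(ℝ, E).tangent w w)] fun _ => 0 := by
    filter_upwards [ht] with q hq
    refine (lagrangeForm_inChart m w hq (0, b)).trans ?_
    exact (congrArg _ (map_zero (mfderiv 𝓘(ℝ, E) 𝓘(ℝ, E)
      (extChartAt 𝓘(ℝ, E) w.proj).symm q.1 : E →L[ℝ] E))).trans (map_zero _)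
  have h1 : fderiv ℝ (fun q => (lagrangeForm m).inChart w q ![X])
      (extChartAt 𝓘(ℝ, E).tangent w w) (0, b) = m.bilin x b X.1 := by
    have hdX : DifferentiableAt ℝ (fun q => (lagrangeForm m).inChart w q ![X])
        (extChartAt 𝓘(ℝ, E).tangent w w) :=
      (ContinuousAlternatingMap.apply ℝ (E × E) ℝ ![X]).differentiableAt.comp _ hd
    rw [hΦ] at hdX ⊢
    -- The other term needs only the restriction to the fibre, where the function is linear.
    have hc := hdX.hasFDerivAt.comp a (hasFDerivAt_prodMk_right (𝕜 := ℝ) (extChartAt 𝓘(ℝ, E) x x) a)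
    have hc' : HasFDerivAt (fun c => m.bilin x c X.1) ((m.bilin x).flip X.1) a :=
      ((m.bilin x).flip X.1).hasFDerivAt
    exact DFunLike.congr_fun (hc.unique (hc'.congr_of_eventuallyEq
      (Filter.Eventually.of_forall fun c => lagrangeForm_inChart_fibre m x a c X))) b
  rw [h0.fderiv_eq]
  have : fderiv ℝ (fun _ : E × E => (0 : ℝ)) (extChartAt 𝓘(ℝ, E).tangent w w) X = 0 := by simp
  rw [this, h1, zero_sub]

end Lagrange

/-! ### Derivatives read between model spaces. -/

section ModelDerivative

variable (E : Type*) {E' E'' : Type*} [NormedAddCommGroup E] [NormedSpace ℝ E]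
  [NormedAddCommGroup E'] [NormedSpace ℝ E'] [NormedAddCommGroup E''] [NormedSpace ℝ E'']
  {M : Type*} [TopologicalSpace M] [ChartedSpace E M]
  {M' : Type*} [TopologicalSpace M'] [ChartedSpace E' M']
  {M'' : Type*} [TopologicalSpace M''] [ChartedSpace E'' M'']

/-- The derivative of `f` at `x`, as a linear map between the model spaces. -/
noncomputable def modelDeriv (E' : Type*) [NormedAddCommGroup E'] [NormedSpace ℝ E']
    [ChartedSpace E' M'] (f : M → M') (x : M) : E →L[ℝ] E' :=
  mfderiv 𝓘(ℝ, E) 𝓘(ℝ, E') f x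

/-- The generating vector field of a flow, with values in the model space. -/
noncomputable def modelGenerator (g : ℝ → M → M) (x : M) : E := generator E g x

variable {E}

theorem modelDeriv_comp {h : M' → M''} {f : M → M'} {x : M} {y : M'} (hy : f x = y)
    (hh : MDifferentiableAt 𝓘(ℝ, E') 𝓘(ℝ, E'') h y) (hf : MDifferentiableAt 𝓘(ℝ, E) 𝓘(ℝ, E') f x)
    (v : E) :
    modelDeriv E E'' (h ∘ f) x v = modelDeriv E' E'' h y (modelDeriv E E' f x v) :=
  mfderiv_comp_apply_of_eq x hh hf hy v

theorem modelDeriv_congr {f f' : M → M'} {x : M} (h : f =ᶠ[𝓝 x] f') :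
    modelDeriv E E' f x = modelDeriv E E' f' x :=
  h.mfderiv_eq

theorem modelDeriv_of_eventuallyEq_id {f : M → M} {x : M} (h : f =ᶠ[𝓝 x] id) (v : E) :
    modelDeriv E E f x v = v := by
  rw [modelDeriv_congr h]
  exact DFunLike.congr_fun (mfderiv_id (I := 𝓘(ℝ, E)) (x := x)) v

end ModelDerivative

/-! ### The one-parameter group and its generator. -/

section Flow

variable {E : Type*} [NormedAddCommGroup E] [NormedSpace ℝ E]
  {M : Type*} [TopologicalSpace M] [ChartedSpace E M] {g : ℝ → M → M}

namespace IsOneParameterGroup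

theorem contMDiff_apply (hg : IsOneParameterGroup E g) (τ : ℝ) :
    ContMDiff 𝓘(ℝ, E) 𝓘(ℝ, E) ∞ (g τ) :=
  hg.smooth.comp (contMDiff_const.prodMk contMDiff_id)

theorem contMDiff_orbit (hg : IsOneParameterGroup E g) (x : M) :
    ContMDiff 𝓘(ℝ, ℝ) 𝓘(ℝ, E) ∞ (fun τ => g τ x) :=
  hg.smooth.comp (contMDiff_id.prodMk contMDiff_const)

theorem mdifferentiableAt_apply (hg : IsOneParameterGroup E g) (τ : ℝ) (x : M) :
    MDifferentiableAt 𝓘(ℝ, E) 𝓘(ℝ, E) (g τ) x :=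
  (hg.contMDiff_apply τ x).mdifferentiableAt (by simp)

theorem mdifferentiableAt_orbit (hg : IsOneParameterGroup E g) (x : M) (τ : ℝ) :
    MDifferentiableAt 𝓘(ℝ, ℝ) 𝓘(ℝ, E) (fun τ => g τ x) τ :=
  (hg.contMDiff_orbit x τ).mdifferentiableAt (by simp)

theorem modelDeriv_orbit (hg : IsOneParameterGroup E g) (x : M) (τ c : ℝ) :
    modelDeriv ℝ E (fun σ => g σ x) τ c = c • modelGenerator E g (g τ x) := by
  -- The group law moves differentiation at time `τ` to time `0` on the orbit of `g τ x`.
  have h1 : (fun σ => g σ x) = (fun σ => g σ (g τ x)) ∘ (fun σ => σ - τ) := by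
    funext σ
    simp [← hg.add]
  have hsub : HasMFDerivAt 𝓘(ℝ, ℝ) 𝓘(ℝ, ℝ) (fun σ : ℝ => σ - τ) τ (ContinuousLinearMap.id ℝ ℝ) :=
    ((hasFDerivAt_id τ).sub_const τ).hasMFDerivAt
  rw [h1, modelDeriv_comp (f := fun σ : ℝ => σ - τ) (y := 0) (sub_self τ) (hg.mdifferentiableAt_orbit _ _)
    hsub.mdifferentiableAt]
  have h2 : modelDeriv ℝ ℝ (fun σ : ℝ => σ - τ) τ c = c • (1 : ℝ) := by
    rw [smul_eq_mul, mul_one]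
    exact DFunLike.congr_fun hsub.mfderiv c
  rw [h2, map_smul]
  rfl

/-- The generating vector field is invariant under the flow. -/
theorem modelDeriv_generator (hg : IsOneParameterGroup E g) (τ : ℝ) (x : M) :
    modelDeriv E E (g τ) x (modelGenerator E g x) = modelGenerator E g (g τ x) := by
  have h1 : (fun σ => g σ (g τ x)) = g τ ∘ fun σ => g σ x := by
    funext σ
    simp only [Function.comp_apply, ← hg.add, add_comm]
  have h2 := modelDeriv_comp (E := ℝ) (f := fun σ => g σ x) (x := 0) (hg.zero x)
    (hg.mdifferentiableAt_apply τ x) (hg.mdifferentiableAt_orbit x 0) 1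
  rw [← h1, hg.modelDeriv_orbit, hg.modelDeriv_orbit, one_smul, one_smul, hg.zero, hg.zero] at h2
  exact h2.symm

/-- The derivative of `y ↦ g (t y) (f y)`. -/
theorem modelDeriv_flow {F : Type*} [NormedAddCommGroup F] [NormedSpace ℝ F]
    {N : Type*} [TopologicalSpace N] [ChartedSpace F N] (hg : IsOneParameterGroup E g)
    {t : N → ℝ} {f : N → M} {y : N} (ht : MDifferentiableAt 𝓘(ℝ, F) 𝓘(ℝ, ℝ) t y)
    (hf : MDifferentiableAt 𝓘(ℝ, F) 𝓘(ℝ, E) f y) (v : F) :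
    modelDeriv F E (fun y => g (t y) (f y)) y v =
      modelDeriv F ℝ t y v • modelGenerator E g (g (t y) (f y)) +
      modelDeriv E E (g (t y)) (f y) (modelDeriv F E f y v) := by
  have hG : MDifferentiableAt (𝓘(ℝ, ℝ).prod 𝓘(ℝ, E)) 𝓘(ℝ, E) (fun z : ℝ × M => g z.1 z.2)
      (t y, f y) := (hg.smooth _).mdifferentiableAt (by simp)
  have h1 := mfderiv_comp_apply (I' := 𝓘(ℝ, ℝ).prod 𝓘(ℝ, E)) y
    (f := fun y => (t y, f y)) hG (ht.prodMk hf) v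
  refine h1.trans ?_
  rw [mfderiv_prodMk ht hf]
  refine (mfderiv_prod_eq_add_apply hG).trans ?_
  rw [← hg.modelDeriv_orbit]
  rfl

theorem contMDiff_generator [IsManifold 𝓘(ℝ, E) ∞ M] (hg : IsOneParameterGroup E g) :
    ContMDiff 𝓘(ℝ, E) 𝓘(ℝ, E).tangent ∞
      (fun x => (⟨x, generator E g x⟩ : TangentBundle 𝓘(ℝ, E) M)) := by
  intro x
  have h1 := ContMDiffAt.mfderiv (I := 𝓘(ℝ, ℝ)) (I' := 𝓘(ℝ, E)) (J := 𝓘(ℝ, E)) (m := ∞) (n := ∞)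
    (fun (y : M) (τ : ℝ) => g τ y) (fun _ : M => (0 : ℝ)) (x₀ := x)
    (ContMDiffAt.comp (x, (0 : ℝ)) (g := fun z : ℝ × M => g z.1 z.2) (f := fun z : M × ℝ => (z.2, z.1))
      hg.smooth.contMDiffAt (contMDiffAt_snd.prodMk contMDiffAt_fst)) contMDiffAt_const le_rfl
  have h2 := ContMDiffAt.clm_apply_of_inCoordinates (b₁ := fun _ : M => (0 : ℝ))
    (b₂ := fun y : M => g 0 y) (v := fun _ : M => (1 : ℝ))
    (ϕ := fun y : M => mfderiv 𝓘(ℝ, ℝ) 𝓘(ℝ, E) (fun τ : ℝ => g τ y) 0) h1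
    (contMDiffAt_const (I' := 𝓘(ℝ, ℝ).tangent) (c := (⟨0, 1⟩ : TangentBundle 𝓘(ℝ, ℝ) ℝ))) (hg.contMDiff_apply 0 x)
  refine h2.congr_of_eventuallyEq (Eventually.of_forall fun y => ?_)
  have : g 0 y = y := hg.zero y
  change (⟨y, modelGenerator E g y⟩ : TangentBundle 𝓘(ℝ, E) M) = ⟨g 0 y, modelGenerator E g y⟩
  rw [this]

end IsOneParameterGroup

end Flow

/-! ### Local slices of the principal bundle. -/

section Slice

variable {E E' : Type*} [NormedAddCommGroup E] [NormedSpace ℝ E]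
  [NormedAddCommGroup E'] [NormedSpace ℝ E']
  {M : Type*} [TopologicalSpace M] [ChartedSpace E M]
  {M' : Type*} [TopologicalSpace M'] [ChartedSpace E' M'] {g : ℝ → M → M} {p : M → M'}

/-- A section `s` of `p` through `x`, with the function `t` such that `g (t y) (s (p y)) = y`
near `x`. -/
structure IsSliceAt (E E' : Type*) [NormedAddCommGroup E] [NormedSpace ℝ E]
    [NormedAddCommGroup E'] [NormedSpace ℝ E']
    {M : Type*} [TopologicalSpace M] [ChartedSpace E M]
    {M' : Type*} [TopologicalSpace M'] [ChartedSpace E' M'] (g : ℝ → M → M) (p : M → M')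
    (x : M) (s : M' → M) (t : M → ℝ) : Prop where
  smooth_section : ContMDiffAt 𝓘(ℝ, E') 𝓘(ℝ, E) ∞ s (p x)
  section_apply : s (p x) = x
  proj_section : ∀ᶠ u in 𝓝 (p x), p (s u) = u
  smooth_time : ContMDiffAt 𝓘(ℝ, E) 𝓘(ℝ, ℝ) ∞ t x
  flow_section : ∀ᶠ y in 𝓝 x, g (t y) (s (p y)) = y
  time_flow : ∀ᶠ τ in 𝓝 (0 : ℝ), t (g τ x) = τ

theorem IsPrincipalBundle.proj_flow (hp : IsPrincipalBundle E E' g p) (τ : ℝ) (x : M) :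
    p (g τ x) = p x :=
  ((hp.fibre x (g τ x)).2 ⟨τ, rfl⟩).symm

/-- The local inverse of the trivialization `(u, τ) ↦ g τ (s₀ u)` has first component `p` and second
component a time. If `x` lies at time `τ₀`, replacing `s₀` by `g τ₀ ∘ s₀` and subtracting `τ₀` from
the time brings the section through `x` at time zero. -/
theorem IsPrincipalBundle.exists_isSliceAt (hg : IsOneParameterGroup E g)
    (hp : IsPrincipalBundle E E' g p) (x : M) : ∃ s t, IsSliceAt E E' g p x s t := by
  obtain ⟨U, hU, hxU, s₀, hs₀, hloc⟩ := hp.locallyTrivial (p x)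
  obtain ⟨τ₀, hτ₀⟩ := (hp.fibre (s₀ (p x)) x).1 (hs₀ _ hxU)
  have h := hloc ⟨(p x, τ₀), hxU, Set.mem_univ _⟩
  set Φ : M' × ℝ → M := fun z => g z.2 (s₀ z.1) with hΦ
  have hΦx : Φ (p x, τ₀) = x := hτ₀
  have hΨ : ContMDiffAt 𝓘(ℝ, E) (𝓘(ℝ, E').prod 𝓘(ℝ, ℝ)) ∞ h.localInverse x := by
    have := h.localInverse_contMDiffAt
    simp only at this
    rwa [hΦx] at this
  have hr : ∀ᶠ y in 𝓝 x, Φ (h.localInverse y) = y := by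
    have := h.localInverse_eventuallyEq_right
    simp only at this
    rwa [hΦx] at this
  have hl : ∀ᶠ z in 𝓝 (p x, τ₀), h.localInverse (Φ z) = z := h.localInverse_eventuallyEq_left
  have hΨx : h.localInverse x = (p x, τ₀) := by
    have := hl.self_of_nhds
    rwa [hΦx] at this
  have hfst : ∀ᶠ y in 𝓝 x, (h.localInverse y).1 = p y := by
    have hm : ∀ᶠ y in 𝓝 x, (h.localInverse y).1 ∈ U := by
      refine (continuous_fst.continuousAt.comp hΨ.continuousAt).eventually_mem (hU.mem_nhds ?_)
      simp only [Function.comp_apply, hΨx]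
      exact hxU
    filter_upwards [hr, hm] with y hy hyU
    conv_rhs => rw [← hy]
    exact ((hp.proj_flow _ _).trans (hs₀ _ hyU)).symm
  refine ⟨fun u => g τ₀ (s₀ u), fun y => (h.localInverse y).2 - τ₀, ?_, hτ₀, ?_, ?_, ?_, ?_⟩
  · exact ContMDiffAt.comp (p x) (g := Φ) (f := fun u => (u, τ₀)) h.contMDiffAt
      (contMDiffAt_id.prodMk contMDiffAt_const)
  · filter_upwards [hU.mem_nhds hxU] with u hu
    exact (hp.proj_flow _ _).trans (hs₀ _ hu)
  · exact (contMDiffAt_snd.comp x hΨ).sub contMDiffAt_const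
  · filter_upwards [hr, hfst] with y hy hy1
    rw [← hg.add, sub_add_cancel, ← hy1]
    exact hy
  · have hc : Tendsto (fun τ : ℝ => (p x, τ + τ₀)) (𝓝 0) (𝓝 (p x, τ₀)) := by
      have : Continuous fun τ : ℝ => (p x, τ + τ₀) := by fun_prop
      simpa using this.tendsto 0
    filter_upwards [hc.eventually hl] with τ hτ
    have : Φ (p x, τ + τ₀) = g τ x := by
      simp only [hΦ, hg.add, hτ₀]
    rw [this] at hτ
    simp [hτ]

namespace IsSliceAt

variable {x : M} {s : M' → M} {t : M → ℝ}

theorem time_apply (hg : IsOneParameterGroup E g) (h : IsSliceAt E E' g p x s t) : t x = 0 := by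
  have := h.time_flow.self_of_nhds
  rwa [hg.zero] at this

/-- Along the orbit of `x` the time function is the identity near `0`. In particular the generator
cannot vanish. -/
theorem modelDeriv_time_generator (hg : IsOneParameterGroup E g) (h : IsSliceAt E E' g p x s t) :
    modelDeriv E ℝ t x (modelGenerator E g x) = 1 := by
  have h1 := modelDeriv_comp (E := ℝ) (f := fun σ => g σ x) (x := 0) (hg.zero x)
    (h.smooth_time.mdifferentiableAt (by simp)) (hg.mdifferentiableAt_orbit x 0) 1
  rw [hg.modelDeriv_orbit, one_smul, hg.zero] at h1
  rw [← h1]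
  exact modelDeriv_of_eventuallyEq_id h.time_flow 1

theorem generator_ne_zero (hg : IsOneParameterGroup E g) (h : IsSliceAt E E' g p x s t) :
    modelGenerator E g x ≠ 0 := by
  intro h0
  have := h.modelDeriv_time_generator hg
  rw [h0, map_zero] at this
  exact zero_ne_one this

end IsSliceAt

variable [IsManifold 𝓘(ℝ, E) ∞ M] [IsManifold 𝓘(ℝ, E') ∞ M']

omit [IsManifold 𝓘(ℝ, E) ∞ M] [IsManifold 𝓘(ℝ, E') ∞ M'] in
theorem IsPrincipalBundle.mdifferentiableAt_proj (hp : IsPrincipalBundle E E' g p) (x : M) :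
    MDifferentiableAt 𝓘(ℝ, E) 𝓘(ℝ, E') p x :=
  (hp.smooth x).mdifferentiableAt (by simp)

omit [IsManifold 𝓘(ℝ, E) ∞ M] [IsManifold 𝓘(ℝ, E') ∞ M'] in
theorem IsPrincipalBundle.modelDeriv_flow (hg : IsOneParameterGroup E g)
    (hp : IsPrincipalBundle E E' g p) (τ : ℝ) (x : M) (v : E) :
    modelDeriv E E' p (g τ x) (modelDeriv E E (g τ) x v) = modelDeriv E E' p x v := by
  rw [← modelDeriv_comp rfl ((hp.smooth _).mdifferentiableAt (by simp))
    (hg.mdifferentiableAt_apply τ x)]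
  exact DFunLike.congr_fun (modelDeriv_congr (Eventually.of_forall fun y => hp.proj_flow τ y)) v

omit [IsManifold 𝓘(ℝ, E) ∞ M] [IsManifold 𝓘(ℝ, E') ∞ M'] in
theorem IsPrincipalBundle.modelDeriv_generator (hg : IsOneParameterGroup E g)
    (hp : IsPrincipalBundle E E' g p) (x : M) :
    modelDeriv E E' p x (modelGenerator E g x) = 0 := by
  have h1 := modelDeriv_comp (E := ℝ) (f := fun σ => g σ x) (x := 0) (hg.zero x)
    ((hp.smooth x).mdifferentiableAt (by simp)) (hg.mdifferentiableAt_orbit x 0) 1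
  rw [hg.modelDeriv_orbit, one_smul, hg.zero] at h1
  have h2 : (p ∘ fun σ => g σ x) = fun _ => p x := funext fun σ => hp.proj_flow σ x
  rw [← h1, h2]
  exact DFunLike.congr_fun (mfderiv_const (I := 𝓘(ℝ, ℝ)) (I' := 𝓘(ℝ, E'))) (1 : ℝ)

namespace IsSliceAt

variable {x : M} {s : M' → M} {t : M → ℝ}

theorem modelDeriv_proj_section (hp : IsPrincipalBundle E E' g p) (h : IsSliceAt E E' g p x s t) :
    ∀ᶠ u in 𝓝 (p x), ∀ a : E', modelDeriv E E' p (s u) (modelDeriv E' E s u a) = a := by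
  have h1 : ∀ᶠ u in 𝓝 (p x), ContMDiffAt 𝓘(ℝ, E') 𝓘(ℝ, E) 1 s u :=
    (contMDiffAt_iff_contMDiffAt_nhds (by simp)).1 (h.smooth_section.of_le (by simp))
  filter_upwards [h1, h.proj_section.eventually_nhds] with u hu hpu a
  rw [← modelDeriv_comp rfl (hp.mdifferentiableAt_proj _) (hu.mdifferentiableAt (by simp))]
  exact modelDeriv_of_eventuallyEq_id hpu a

theorem modelDeriv_proj_section_self (hp : IsPrincipalBundle E E' g p)
    (h : IsSliceAt E E' g p x s t) (a : E') :
    modelDeriv E E' p x (modelDeriv E' E s (p x) a) = a := by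
  have := (h.modelDeriv_proj_section hp).self_of_nhds a
  rwa [h.section_apply] at this

omit [IsManifold 𝓘(ℝ, E) ∞ M] [IsManifold 𝓘(ℝ, E') ∞ M'] in
theorem tendsto_proj (hp : IsPrincipalBundle E E' g p) : Tendsto p (𝓝 x) (𝓝 (p x)) :=
  (hp.smooth.continuous.continuousAt)

/-- Near `x` every tangent vector splits into a transported horizontal part and a multiple of
the generator. -/
theorem decomp (hg : IsOneParameterGroup E g) (hp : IsPrincipalBundle E E' g p)
    (h : IsSliceAt E E' g p x s t) :
    ∀ᶠ y in 𝓝 x, ∀ Y : E, Y = modelDeriv E ℝ t y Y • modelGenerator E g y +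
      modelDeriv E E (g (t y)) (s (p y)) (modelDeriv E E (s ∘ p) y Y) := by
  have h1 : ∀ᶠ u in 𝓝 (p x), ContMDiffAt 𝓘(ℝ, E') 𝓘(ℝ, E) 1 s u :=
    (contMDiffAt_iff_contMDiffAt_nhds (by simp)).1 (h.smooth_section.of_le (by simp))
  have h2 : ∀ᶠ y in 𝓝 x, ContMDiffAt 𝓘(ℝ, E) 𝓘(ℝ, ℝ) 1 t y :=
    (contMDiffAt_iff_contMDiffAt_nhds (by simp)).1 (h.smooth_time.of_le (by simp))
  filter_upwards [(tendsto_proj hp).eventually h1, h2, h.flow_section.eventually_nhds]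
    with y hy1 hy2 hy3 Y
  have hsp : MDifferentiableAt 𝓘(ℝ, E) 𝓘(ℝ, E) (s ∘ p) y :=
    (hy1.mdifferentiableAt (by simp)).comp y (hp.mdifferentiableAt_proj y)
  -- Differentiate the identity `g (t y) (s (p y)) = y`, which holds in a neighbourhood.
  have h4 := hg.modelDeriv_flow (hy2.mdifferentiableAt (by simp)) hsp Y
  rw [modelDeriv_of_eventuallyEq_id (f := fun y => g (t y) ((s ∘ p) y)) hy3,
    Function.comp_apply, hy3.self_of_nhds] at h4
  exact h4

theorem decomp_self (hg : IsOneParameterGroup E g) (hp : IsPrincipalBundle E E' g p)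
    (h : IsSliceAt E E' g p x s t) (Y : E) :
    Y = modelDeriv E ℝ t x Y • modelGenerator E g x +
      modelDeriv E' E s (p x) (modelDeriv E E' p x Y) := by
  have h1 := (h.decomp hg hp).self_of_nhds Y
  rw [h.time_apply hg, h.section_apply,
    modelDeriv_comp rfl (h.smooth_section.mdifferentiableAt (by simp))
      (hp.mdifferentiableAt_proj x)] at h1
  have h2 : ∀ Z : E, modelDeriv E E (g 0) x Z = Z :=
    modelDeriv_of_eventuallyEq_id (Eventually.of_forall hg.zero)
  rwa [h2] at h1

end IsSliceAt

end Slice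

/-! ### The horizontal part of the metric, the connection form and its curvature. -/

section Invariant

variable {E E' : Type*} [NormedAddCommGroup E] [NormedSpace ℝ E]
  [NormedAddCommGroup E'] [NormedSpace ℝ E']
  {M : Type*} [TopologicalSpace M] [ChartedSpace E M] [IsManifold 𝓘(ℝ, E) ∞ M]
  {M' : Type*} [TopologicalSpace M'] [ChartedSpace E' M'] [IsManifold 𝓘(ℝ, E') ∞ M']
  {g : ℝ → M → M} {p : M → M'}

omit [IsManifold 𝓘(ℝ, E) ∞ M] [IsManifold 𝓘(ℝ, E') ∞ M'] in
/-- Binary tensors on `M`, invariant and horizontal, descend along `p`. -/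
theorem IsPrincipalBundle.exists_descent (hg : IsOneParameterGroup E g)
    (hp : IsPrincipalBundle E E' g p) : ∃ (x₀ : M' → M) (σ : M' → E' →L[ℝ] E),
    (∀ u, p (x₀ u) = u) ∧ ∀ T : M → E → E → ℝ,
      (∀ τ x X Y, T (g τ x) (modelDeriv E E (g τ) x X) (modelDeriv E E (g τ) x Y) = T x X Y) →
      (∀ x s t, IsSliceAt E E' g p x s t → ∀ X Y, T x X Y =
        T x (modelDeriv E' E s (p x) (modelDeriv E E' p x X))
          (modelDeriv E' E s (p x) (modelDeriv E E' p x Y))) →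
      ∀ x X Y, T x X Y = T (x₀ (p x)) (σ (p x) (modelDeriv E E' p x X))
        (σ (p x) (modelDeriv E E' p x Y)) := by
  -- The base points are chosen with no regularity; smoothness of what descends is checked later on
  -- smooth local sections.
  choose x₀ hx₀ using hp.surjective
  choose s t hst using fun u => hp.exists_isSliceAt hg (x₀ u)
  refine ⟨x₀, fun u => modelDeriv E' E (s u) (p (x₀ u)), hx₀, fun T h1 h2 x X Y => ?_⟩
  obtain ⟨τ, hτ⟩ := (hp.fibre x (x₀ (p x))).1 (hx₀ (p x)).symm
  -- Invariance carries the tensor along the orbit to the chosen base point, where horizontality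
  -- makes it depend only on the images under `Tp`.
  rw [← h1 τ x X Y, h2 (g τ x) (s (p x)) (t (p x)) (by rw [hτ]; exact hst (p x)),
    hp.modelDeriv_flow hg, hp.modelDeriv_flow hg, hτ]

namespace SmoothMetric

omit [IsManifold 𝓘(ℝ, E') ∞ M'] in
theorem bilin_symm (m : SmoothMetric E M) (x : M) (X Y : E) : m.bilin x X Y = m.bilin x Y X :=
  m.symm x X Y

theorem bilin_pos (m : SmoothMetric E M) (x : M) {X : E} (hX : X ≠ 0) : 0 < m.bilin x X X :=
  m.pos x X hX

/-- The part of the metric on vectors orthogonal to the generator. -/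
noncomputable def horizontal (m : SmoothMetric E M) (g : ℝ → M → M) (x : M) : E →L[ℝ] E →L[ℝ] ℝ :=
  m.bilin x - (m.bilin x (modelGenerator E g x) (modelGenerator E g x))⁻¹ •
    (m.bilin x (modelGenerator E g x)).smulRight (m.bilin x (modelGenerator E g x))

theorem horizontal_apply (m : SmoothMetric E M) (g : ℝ → M → M) (x : M) (X Y : E) :
    m.horizontal g x X Y = m.bilin x X Y -
      (m.bilin x (modelGenerator E g x) (modelGenerator E g x))⁻¹ *
      (m.bilin x (modelGenerator E g x) X * m.bilin x (modelGenerator E g x) Y) := by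
  simp [horizontal]

theorem horizontal_symm (m : SmoothMetric E M) (g : ℝ → M → M) (x : M) (X Y : E) :
    m.horizontal g x X Y = m.horizontal g x Y X := by
  rw [horizontal_apply, horizontal_apply, m.bilin_symm x X Y]
  ring

theorem horizontal_generator (m : SmoothMetric E M) {x : M} (hx : modelGenerator E g x ≠ 0)
    (X : E) : m.horizontal g x X (modelGenerator E g x) = 0 := by
  have := (m.bilin_pos x hx).ne'
  rw [horizontal_apply, m.bilin_symm x X]
  field_simp
  ring

/-- The generator lies in the radical of the horizontal form. As it is also the vertical direction
of `p`, this is what lets the form descend. -/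
theorem horizontal_add_generator (m : SmoothMetric E M) {x : M} (hx : modelGenerator E g x ≠ 0)
    (X Y : E) (a b : ℝ) : m.horizontal g x (a • modelGenerator E g x + X)
      (b • modelGenerator E g x + Y) = m.horizontal g x X Y := by
  simp only [map_add, map_smul, m.horizontal_generator hx, add_apply,
    smul_apply, smul_zero, zero_add]
  rw [m.horizontal_symm g x (modelGenerator E g x), m.horizontal_generator hx, smul_zero, zero_add]

/-- A tangent vector minus its component along the generator. -/
noncomputable def horizontalPart (m : SmoothMetric E M) (g : ℝ → M → M) (x : M) (X : E) : E :=
  X - ((m.bilin x (modelGenerator E g x) (modelGenerator E g x))⁻¹ *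
    m.bilin x (modelGenerator E g x) X) • modelGenerator E g x

theorem bilin_generator_horizontalPart (m : SmoothMetric E M) {x : M}
    (hx : modelGenerator E g x ≠ 0) (X : E) :
    m.bilin x (modelGenerator E g x) (m.horizontalPart g x X) = 0 := by
  have := (m.bilin_pos x hx).ne'
  rw [horizontalPart, map_sub, map_smul, smul_eq_mul]
  field_simp
  ring

/-- Subtracting the generator components changes nothing, and what remains is orthogonal to the
generator. This gives positivity of the reduced metric and the link with vectors of zero momentum.
-/
theorem horizontal_eq (m : SmoothMetric E M) {x : M} (hx : modelGenerator E g x ≠ 0) (X Y : E) :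
    m.horizontal g x X Y = m.bilin x (m.horizontalPart g x X) (m.horizontalPart g x Y) := by
  have h1 : ∀ Z, Z = ((m.bilin x (modelGenerator E g x) (modelGenerator E g x))⁻¹ *
    m.bilin x (modelGenerator E g x) Z) • modelGenerator E g x + m.horizontalPart g x Z := by
    intro Z; rw [horizontalPart]; abel
  conv_lhs => rw [h1 X, h1 Y]
  rw [m.horizontal_add_generator hx, horizontal_apply, m.bilin_generator_horizontalPart hx]
  ring

end SmoothMetric

theorem PreservesMetric.bilin {m : SmoothMetric E M} (hm : PreservesMetric m g) (τ : ℝ) (x : M)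
    (X Y : E) : m.bilin (g τ x) (modelDeriv E E (g τ) x X) (modelDeriv E E (g τ) x Y) =
      m.bilin x X Y :=
  hm τ x X Y

theorem PreservesMetric.horizontal {m : SmoothMetric E M} (hg : IsOneParameterGroup E g)
    (hm : PreservesMetric m g) (τ : ℝ) (x : M) (X Y : E) :
    m.horizontal g (g τ x) (modelDeriv E E (g τ) x X) (modelDeriv E E (g τ) x Y) =
      m.horizontal g x X Y := by
  simp only [SmoothMetric.horizontal_apply, ← hg.modelDeriv_generator, hm.bilin]

theorem horizontal_slice (m : SmoothMetric E M) (hg : IsOneParameterGroup E g)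
    (hp : IsPrincipalBundle E E' g p) {x : M} {s : M' → M} {t : M → ℝ}
    (h : IsSliceAt E E' g p x s t) (X Y : E) : m.horizontal g x X Y =
      m.horizontal g x (modelDeriv E' E s (p x) (modelDeriv E E' p x X))
        (modelDeriv E' E s (p x) (modelDeriv E E' p x Y)) := by
  conv_lhs => rw [h.decomp_self hg hp X, h.decomp_self hg hp Y]
  exact m.horizontal_add_generator (h.generator_ne_zero hg) _ _ _ _

/-- The connection form of the bundle defined by the metric. -/
noncomputable def connectionForm (m : SmoothMetric E M) (g : ℝ → M → M) : DForm 𝓘(ℝ, E) M 1 :=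
  fun x => ContinuousAlternatingMap.ofSubsingleton ℝ E ℝ (0 : Fin 1)
    ((m.bilin x (modelGenerator E g x) (modelGenerator E g x))⁻¹ •
      m.bilin x (modelGenerator E g x))

theorem connectionForm_isSmooth [FiniteDimensional ℝ E] (m : SmoothMetric E M)
    (hg : IsOneParameterGroup E g) (hv : ∀ x, modelGenerator E g x ≠ 0) :
    (connectionForm m g).IsSmooth := by
  refine DForm.isSmooth_iff_smoothAt.2 fun x => DForm.smoothAt_one_of_apply fun Z => ?_
  have hφ := contMDiffAt_extChartAt_symm_of_boundaryless (I := 𝓘(ℝ, E))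
    (mem_extChartAt_target (I := 𝓘(ℝ, E)) x)
  have hgen : ContMDiffAt 𝓘(ℝ, E) 𝓘(ℝ, E).tangent ∞ (fun y : E =>
      (⟨(extChartAt 𝓘(ℝ, E) x).symm y, generator E g ((extChartAt 𝓘(ℝ, E) x).symm y)⟩ :
        TangentBundle 𝓘(ℝ, E) M)) (extChartAt 𝓘(ℝ, E) x x) :=
    ContMDiffAt.comp (extChartAt 𝓘(ℝ, E) x x)
      (g := fun x => (⟨x, generator E g x⟩ : TangentBundle 𝓘(ℝ, E) M))
      hg.contMDiff_generator.contMDiffAt hφ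
  have h1 := m.contMDiffAt_inner hgen hgen
  have h2 := m.contMDiffAt_inner hgen (contMDiffAt_coordinateField x Z)
  exact (h1.contDiffAt.inv (m.bilin_pos _ (hv _)).ne').mul h2.contDiffAt

theorem connectionForm_pullback_flow {m : SmoothMetric E M} (hg : IsOneParameterGroup E g)
    (hm : PreservesMetric m g) (τ : ℝ) :
    (connectionForm m g).pullback 𝓘(ℝ, E) (g τ) = connectionForm m g := by
  funext x
  ext X
  have key : ∀ Z : E, (m.bilin (g τ x) (modelGenerator E g (g τ x))
      (modelGenerator E g (g τ x)))⁻¹ *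
      m.bilin (g τ x) (modelGenerator E g (g τ x)) (modelDeriv E E (g τ) x Z) =
      (m.bilin x (modelGenerator E g x) (modelGenerator E g x))⁻¹ *
        m.bilin x (modelGenerator E g x) Z := by
    intro Z
    rw [← hg.modelDeriv_generator, hm.bilin, hm.bilin]
  exact key (X 0)

/-- The standard `1`-form on the real line. -/
noncomputable def lineForm : DForm 𝓘(ℝ, ℝ) ℝ 1 :=
  fun _ => ContinuousAlternatingMap.ofSubsingleton ℝ ℝ ℝ (0 : Fin 1) (ContinuousLinearMap.id ℝ ℝ)

theorem lineForm_smoothAt (x : ℝ) : lineForm.SmoothAt x := by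
  refine DForm.smoothAt_one_of_apply fun Z => ?_
  refine (contDiffAt_const (c := Z)).congr_of_eventuallyEq (Eventually.of_forall fun y => ?_)
  change mfderiv 𝓘(ℝ, ℝ) 𝓘(ℝ, ℝ) (extChartAt 𝓘(ℝ, ℝ) x).symm y Z = Z
  rw [extChartAt_model_space_eq_id]
  exact DFunLike.congr_fun (mfderiv_id (I := 𝓘(ℝ, ℝ)) (x := y)) Z

theorem alternating_two_real_eq_zero (η : ℝ [⋀^Fin 2]→L[ℝ] ℝ) : η = 0 := by
  refine ContinuousAlternatingMap.ext fun v => ?_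
  refine η.toAlternatingMap.map_linearDependent v fun h => ?_
  have := h.fintype_card_le_finrank
  simp at this

/-- Near `x` a vector is the flow transport of its image under `T(s ∘ p)` plus `dt` of it times the
generator. The connection form is flow-invariant and equals `1` on the generator, whence `α = (s ∘
p)^* α + dt`. -/
theorem connectionForm_slice {m : SmoothMetric E M} (hg : IsOneParameterGroup E g)
    (hp : IsPrincipalBundle E E' g p) (hm : PreservesMetric m g)
    (hv : ∀ x, modelGenerator E g x ≠ 0) {x : M} {s : M' → M} {t : M → ℝ}
    (h : IsSliceAt E E' g p x s t) : ∀ᶠ y in 𝓝 x, connectionForm m g y =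
      ((connectionForm m g).pullback 𝓘(ℝ, E) (s ∘ p) +
        (1 : ℝ) • lineForm.pullback 𝓘(ℝ, E) t : DForm 𝓘(ℝ, E) M 1) y := by
  filter_upwards [h.decomp hg hp, h.flow_section] with y hy hfy
  ext Y
  change (m.bilin y (modelGenerator E g y) (modelGenerator E g y))⁻¹ *
      m.bilin y (modelGenerator E g y) (Y 0) =
    (m.bilin (s (p y)) (modelGenerator E g (s (p y))) (modelGenerator E g (s (p y))))⁻¹ *
      m.bilin (s (p y)) (modelGenerator E g (s (p y))) (modelDeriv E E (s ∘ p) y (Y 0)) +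
    (1 : ℝ) * modelDeriv E ℝ t y (Y 0)
  have hvv := (m.bilin_pos y (hv y)).ne'
  have h1 : modelGenerator E g y =
      modelDeriv E E (g (t y)) (s (p y)) (modelGenerator E g (s (p y))) := by
    rw [hg.modelDeriv_generator, hfy]
  have h2 : ∀ Z W, m.bilin y (modelDeriv E E (g (t y)) (s (p y)) Z)
      (modelDeriv E E (g (t y)) (s (p y)) W) = m.bilin (s (p y)) Z W := by
    intro Z W
    have := hm.bilin (t y) (s (p y)) Z W
    rwa [hfy] at this
  conv_lhs => rw [hy (Y 0)]
  rw [map_add, map_smul, smul_eq_mul, mul_add, mul_comm (modelDeriv E ℝ t y (Y 0)),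
    inv_mul_cancel_left₀ hvv]
  rw [← h2, ← h2, ← h1]
  ring

variable [FiniteDimensional ℝ E]

/-- The summand `dt` is closed because `2`-forms on the line vanish. Thus `dα` is horizontal
although `α` is not. -/
theorem connectionForm_d_slice {m : SmoothMetric E M} (hg : IsOneParameterGroup E g)
    (hp : IsPrincipalBundle E E' g p) (hm : PreservesMetric m g)
    (hv : ∀ x, modelGenerator E g x ≠ 0) {x : M} {s : M' → M} {t : M → ℝ}
    (h : IsSliceAt E E' g p x s t) :
    (connectionForm m g).d x = (connectionForm m g).d.pullback 𝓘(ℝ, E) (s ∘ p) x := by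
  have hsm := DForm.isSmooth_iff_smoothAt.1 (connectionForm_isSmooth m hg hv)
  have hsp : ContMDiffAt 𝓘(ℝ, E) 𝓘(ℝ, E) ∞ (s ∘ p) x := h.smooth_section.comp x (hp.smooth x)
  rw [DForm.d_congr (connectionForm_slice hg hp hm hv h),
    ((hsm _).pullback hsp).d_add_smul ((lineForm_smoothAt _).pullback h.smooth_time),
    DForm.d_pullback (hsm _) hsp, DForm.d_pullback (lineForm_smoothAt _) h.smooth_time]
  have : lineForm.d.pullback 𝓘(ℝ, E) t x = 0 := by
    ext Y
    exact DFunLike.congr_fun (alternating_two_real_eq_zero (lineForm.d (t x))) _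
  rw [this, smul_zero, add_zero]

/-- The curvature form on the base. -/
theorem exists_curvature [FiniteDimensional ℝ E'] {m : SmoothMetric E M}
    (hg : IsOneParameterGroup E g)
    (hp : IsPrincipalBundle E E' g p) (hm : PreservesMetric m g)
    (hv : ∀ x, modelGenerator E g x ≠ 0) : ∃ K : DForm 𝓘(ℝ, E') M' 2,
    K.IsSmooth ∧ K.d = 0 ∧ K.pullback 𝓘(ℝ, E) p = (connectionForm m g).d := by
  have hs := connectionForm_isSmooth m hg hv
  have hds := DForm.isSmooth_iff_smoothAt.1 hs.d
  have hpull : ∀ τ x, (connectionForm m g).d.pullback 𝓘(ℝ, E) (g τ) x =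
      (connectionForm m g).d x := by
    intro τ x
    rw [← DForm.d_pullback (DForm.isSmooth_iff_smoothAt.1 hs _) (hg.contMDiff_apply τ x),
      connectionForm_pullback_flow hg hm]
  obtain ⟨x₀, σ, hx₀, hdesc⟩ := hp.exists_descent hg
  let A : M → E [⋀^Fin 2]→L[ℝ] ℝ := (connectionForm m g).d
  have hA := hdesc (fun x X Y => A x ![X, Y])
    (fun τ x X Y => by
      have := DFunLike.congr_fun (hpull τ x) ![X, Y]
      refine Eq.trans (congrArg (A (g τ x)) ?_) this
      funext i; fin_cases i <;> rfl)
    (fun x s t h X Y => by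
      have h1 := DFunLike.congr_fun (connectionForm_d_slice hg hp hm hv h) ![X, Y]
      refine h1.trans ?_
      refine DForm.apply_congr (I := 𝓘(ℝ, E)) (connectionForm m g).d h.section_apply (funext fun i => ?_)
      have hc := modelDeriv_comp (f := p) (x := x) rfl
        (h.smooth_section.mdifferentiableAt (by simp)) (hp.mdifferentiableAt_proj x)
      fin_cases i
      · exact hc X
      · exact hc Y)
  let K : DForm 𝓘(ℝ, E') M' 2 := fun u => (A (x₀ u)).compContinuousLinearMap (σ u)
  have hK : K.pullback 𝓘(ℝ, E) p = (connectionForm m g).d := by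
    funext x
    ext Y
    have h1 := hA x (Y 0) (Y 1)
    have h2 : (![Y 0, Y 1] : Fin 2 → E) = Y := by funext i; fin_cases i <;> rfl
    rw [h2] at h1
    refine Eq.trans (congrArg (A (x₀ (p x))) (funext fun i => ?_)) h1.symm
    fin_cases i <;> rfl
  -- Near each point `K` is the pull-back of `dα` by a smooth section, so it inherits smoothness and
  -- closedness.
  have hKs : ∀ u, ∃ s : M' → M, ContMDiffAt 𝓘(ℝ, E') 𝓘(ℝ, E) ∞ s u ∧
      ∀ᶠ u' in 𝓝 u, K u' = (connectionForm m g).d.pullback 𝓘(ℝ, E') s u' := by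
    intro u
    obtain ⟨x, rfl⟩ := hp.surjective u
    obtain ⟨s, t, h⟩ := hp.exists_isSliceAt hg x
    refine ⟨s, h.smooth_section, ?_⟩
    filter_upwards [h.proj_section, h.modelDeriv_proj_section hp] with u' hu hu'
    rw [← hK]
    ext Y
    exact (DForm.apply_congr K hu (funext fun i => hu' (Y i))).symm
  refine ⟨K, DForm.isSmooth_iff_smoothAt.2 fun u => ?_, funext fun u => ?_, hK⟩
  · obtain ⟨s, hs, he⟩ := hKs u
    exact ((hds _).pullback hs).congr he
  · obtain ⟨s, hss, he⟩ := hKs u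
    rw [DForm.d_congr he, DForm.d_pullback (hds _) hss, hs.d_d]
    rfl

end Invariant

/-- If `μ > 0` is the minimum of `B` on the unit sphere, then `μ ‖v‖² ≤ B v v`, so the set lies in
the ball of radius `1 / √μ`. The sphere is empty only for the zero space, treated apart. -/
theorem isVonNBounded_of_pos {E : Type*} [NormedAddCommGroup E] [NormedSpace ℝ E]
    [FiniteDimensional ℝ E] (B : E →L[ℝ] E →L[ℝ] ℝ) (hB : ∀ v, v ≠ 0 → 0 < B v v) :
    Bornology.IsVonNBounded ℝ {v : E | B v v < 1} := by
  have : ProperSpace E := FiniteDimensional.proper_real E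
  rw [NormedSpace.isVonNBounded_iff, isBounded_iff_forall_norm_le]
  rcases (Metric.sphere (0 : E) 1).eq_empty_or_nonempty with h | h
  · refine ⟨0, fun v _ => ?_⟩
    by_contra! hv
    have : (‖v‖⁻¹ • v) ∈ Metric.sphere (0 : E) 1 := by
      simp [norm_smul, hv.ne']
    rw [h] at this
    exact this
  · have hcont : Continuous fun v => B v v := by fun_prop
    obtain ⟨u, hu, hmin⟩ := (isCompact_sphere (0 : E) 1).exists_isMinOn h hcont.continuousOn
    have hu0 : 0 < B u u := hB u (ne_zero_of_mem_unit_sphere ⟨u, hu⟩)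
    refine ⟨(Real.sqrt (B u u))⁻¹, fun v hv => ?_⟩
    rcases eq_or_ne v 0 with rfl | hv0
    · simp
    have hn : 0 < ‖v‖ := norm_pos_iff.2 hv0
    have h1 : B u u ≤ B (‖v‖⁻¹ • v) (‖v‖⁻¹ • v) :=
      hmin (by simp [norm_smul, hn.ne'])
    simp only [map_smul, smul_apply, smul_eq_mul] at h1
    have h2 : B u u * ‖v‖ ^ 2 < 1 := by
      have : B u u * ‖v‖ ^ 2 ≤ B v v := by
        calc B u u * ‖v‖ ^ 2 ≤ (‖v‖⁻¹ * (‖v‖⁻¹ * B v v)) * ‖v‖ ^ 2 := by gcongr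
          _ = B v v := by field_simp
      exact this.trans_lt hv
    rw [← Real.sqrt_inv]
    refine Real.le_sqrt_of_sq_le ?_
    rw [le_inv_comm₀ (by positivity) hu0, ← one_div, le_div_iff₀ (by positivity)]
    exact h2.le

/-! ### Existence and uniqueness of the reduced metric. -/

section Reduced

variable {E E' : Type*} [NormedAddCommGroup E] [NormedSpace ℝ E]
  [NormedAddCommGroup E'] [NormedSpace ℝ E']
  {M : Type*} [TopologicalSpace M] [ChartedSpace E M]
  {M' : Type*} [TopologicalSpace M'] [ChartedSpace E' M']
  {g : ℝ → M → M} {p : M → M'}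

theorem IsPrincipalBundle.generator_ne_zero (hg : IsOneParameterGroup E g)
    (hp : IsPrincipalBundle E E' g p) (x : M) : modelGenerator E g x ≠ 0 := by
  obtain ⟨s, t, h⟩ := hp.exists_isSliceAt hg x
  exact h.generator_ne_zero hg

variable [IsManifold 𝓘(ℝ, E) ∞ M] [IsManifold 𝓘(ℝ, E') ∞ M'] {m : SmoothMetric E M}
  {m' : SmoothMetric E' M'}

theorem IsPrincipalBundle.modelDeriv_surjective (hg : IsOneParameterGroup E g)
    (hp : IsPrincipalBundle E E' g p) (x : M) : Function.Surjective (modelDeriv E E' p x) := by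
  obtain ⟨s, t, h⟩ := hp.exists_isSliceAt hg x
  exact fun a => ⟨_, h.modelDeriv_proj_section_self hp a⟩

omit [IsManifold 𝓘(ℝ, E') ∞ M'] in
theorem IsPrincipalBundle.modelDeriv_horizontalPart (hg : IsOneParameterGroup E g)
    (hp : IsPrincipalBundle E E' g p) (m : SmoothMetric E M) (x : M) (X : E) :
    modelDeriv E E' p x (m.horizontalPart g x X) = modelDeriv E E' p x X := by
  rw [SmoothMetric.horizontalPart, map_sub, map_smul, hp.modelDeriv_generator hg, smul_zero,
    sub_zero]

omit [IsManifold 𝓘(ℝ, E) ∞ M] in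
theorem SmoothMetric.ext_bilin {m₁ m₂ : SmoothMetric E' M'}
    (h : ∀ u a b, m₁.bilin u a b = m₂.bilin u a b) : m₁ = m₂ := by
  have h1 : m₁.inner = m₂.inner := by
    funext u
    exact ContinuousLinearMap.ext fun a => ContinuousLinearMap.ext fun b => h u a b
  cases m₁; cases m₂; congr

/-- A vector and its horizontal part have the same image under `Tp`, and the horizontal part has
zero momentum. The restricted condition thus becomes an identity for all pairs of vectors. -/
theorem isReducedMetric_iff (hg : IsOneParameterGroup E g) (hp : IsPrincipalBundle E E' g p) :
    IsReducedMetric m g p m' ↔ ∀ x X Y, m'.bilin (p x) (modelDeriv E E' p x X)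
      (modelDeriv E E' p x Y) = m.horizontal g x X Y := by
  constructor
  · intro h x X Y
    have hx := hp.generator_ne_zero hg x
    have := h x (m.horizontalPart g x X) (m.horizontalPart g x Y)
      (m.bilin_generator_horizontalPart hx X) (m.bilin_generator_horizontalPart hx Y)
    rw [m.horizontal_eq hx, ← hp.modelDeriv_horizontalPart hg m x X,
      ← hp.modelDeriv_horizontalPart hg m x Y]
    exact this
  · intro h x X Y hX hY
    refine (h x X Y).trans ?_
    have hX' : m.bilin x (modelGenerator E g x) X = 0 := hX
    refine (m.horizontal_apply g x X Y).trans ?_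
    rw [hX', zero_mul, mul_zero, sub_zero]
    rfl

theorem isReducedMetric_unique (hg : IsOneParameterGroup E g) (hp : IsPrincipalBundle E E' g p)
    {m₁ m₂ : SmoothMetric E' M'} (h₁ : IsReducedMetric m g p m₁) (h₂ : IsReducedMetric m g p m₂) :
    m₁ = m₂ := by
  rw [isReducedMetric_iff hg hp] at h₁ h₂
  refine SmoothMetric.ext_bilin fun u a b => ?_
  obtain ⟨x, rfl⟩ := hp.surjective u
  obtain ⟨X, rfl⟩ := hp.modelDeriv_surjective hg x a
  obtain ⟨Y, rfl⟩ := hp.modelDeriv_surjective hg x b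
  rw [h₁, h₂]

/-- The horizontal form descends, being invariant and degenerate along the generator. Near a point
the descended form is its pull-back by a smooth section, so it is smooth. -/
theorem exists_isReducedMetric [FiniteDimensional ℝ E'] (hg : IsOneParameterGroup E g)
    (hp : IsPrincipalBundle E E' g p) (hm : PreservesMetric m g) :
    ∃ m' : SmoothMetric E' M', IsReducedMetric m g p m' := by
  obtain ⟨x₀, σ, hx₀, hdesc⟩ := hp.exists_descent hg
  let B : M' → E' →L[ℝ] E' →L[ℝ] ℝ := fun u =>
    (m.horizontal g (x₀ u)).bilinearComp (σ u) (σ u)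
  have hB : ∀ x X Y, B (p x) (modelDeriv E E' p x X) (modelDeriv E E' p x Y) =
      m.horizontal g x X Y := fun x X Y =>
    (hdesc (fun x X Y => m.horizontal g x X Y) (hm.horizontal hg)
      (fun x s t h X Y => horizontal_slice m hg hp h X Y) x X Y).symm
  have hpos : ∀ u a, a ≠ 0 → 0 < B u a a := by
    intro u a ha
    obtain ⟨x, rfl⟩ := hp.surjective u
    obtain ⟨X, rfl⟩ := hp.modelDeriv_surjective hg x a
    rw [hB, m.horizontal_eq (hp.generator_ne_zero hg x)]
    refine m.bilin_pos x fun h0 => ha ?_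
    rw [← hp.modelDeriv_horizontalPart hg m, h0, map_zero]
  let m' : SmoothMetric E' M' :=
    { inner := B
      symm := fun u a b => m.horizontal_symm g _ _ _
      pos := hpos
      isVonNBounded := fun u => isVonNBounded_of_pos (B u) (hpos u)
      contMDiff := by
        intro u
        obtain ⟨x, rfl⟩ := hp.surjective u
        obtain ⟨s, t, h⟩ := hp.exists_isSliceAt hg x
        refine contMDiffAt_bilin_of_apply fun v w hv hw => ?_
        have hgen : ContMDiffAt 𝓘(ℝ, E') 𝓘(ℝ, E).tangent ∞ (fun u =>
            (⟨s u, generator E g (s u)⟩ : TangentBundle 𝓘(ℝ, E) M)) (p x) :=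
          ContMDiffAt.comp (p x)
            (g := fun x => (⟨x, generator E g x⟩ : TangentBundle 𝓘(ℝ, E) M))
            hg.contMDiff_generator.contMDiffAt h.smooth_section
        have hv' := contMDiffAt_mfderiv_apply (b := fun u => u) h.smooth_section hv
        have hw' := contMDiffAt_mfderiv_apply (b := fun u => u) h.smooth_section hw
        have h1 := (m.contMDiffAt_inner hv' hw').sub
          (((m.contMDiffAt_inner hgen hgen).inv₀
            (m.bilin_pos _ (hp.generator_ne_zero hg (s (p x)))).ne').mul
          ((m.contMDiffAt_inner hgen hv').mul (m.contMDiffAt_inner hgen hw')))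
        refine h1.congr_of_eventuallyEq ?_
        filter_upwards [h.proj_section, h.modelDeriv_proj_section hp] with u hu hu'
        have h2 : ∀ a b : E', B u a b = m.horizontal g (s u) (modelDeriv E' E s u a)
            (modelDeriv E' E s u b) := by
          intro a b
          rw [← hB, hu', hu', hu]
        exact (h2 _ _).trans (m.horizontal_apply g _ _ _) }
  exact ⟨m', (isReducedMetric_iff hg hp).2 hB⟩

end Reduced

/-! ### The derivative of `Tp`, momentum levels, and uniqueness of descent. -/

section SecondTangent

variable {E E' : Type*} [NormedAddCommGroup E] [NormedSpace ℝ E]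
  [NormedAddCommGroup E'] [NormedSpace ℝ E']
  {M : Type*} [TopologicalSpace M] [ChartedSpace E M] [IsManifold 𝓘(ℝ, E) ∞ M]
  {M' : Type*} [TopologicalSpace M'] [ChartedSpace E' M'] [IsManifold 𝓘(ℝ, E') ∞ M']
  {g : ℝ → M → M} {p : M → M'} {m : SmoothMetric E M} {m' : SmoothMetric E' M'}

/-- The derivative of the tangent map, as a linear map between the model spaces. -/
noncomputable def tangentMapDeriv (E E' : Type*) [NormedAddCommGroup E] [NormedSpace ℝ E]
    [NormedAddCommGroup E'] [NormedSpace ℝ E']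
    {M : Type*} [TopologicalSpace M] [ChartedSpace E M] [IsManifold 𝓘(ℝ, E) ∞ M]
    {M' : Type*} [TopologicalSpace M'] [ChartedSpace E' M'] [IsManifold 𝓘(ℝ, E') ∞ M']
    (p : M → M') (w : TangentBundle 𝓘(ℝ, E) M) :
    E × E →L[ℝ] E' × E' :=
  mfderiv 𝓘(ℝ, E).tangent 𝓘(ℝ, E').tangent (tangentMap 𝓘(ℝ, E) 𝓘(ℝ, E') p) w

/-- Differentiate `π ∘ Tp = p ∘ π`. -/
theorem tangentMapDeriv_fst (hp : ContMDiff 𝓘(ℝ, E) 𝓘(ℝ, E') ∞ p)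
    (w : TangentBundle 𝓘(ℝ, E) M) (X : E × E) :
    (tangentMapDeriv E E' p w X).1 = modelDeriv E E' p w.proj X.1 := by
  have hT : MDifferentiableAt 𝓘(ℝ, E).tangent 𝓘(ℝ, E').tangent
      (tangentMap 𝓘(ℝ, E) 𝓘(ℝ, E') p) w :=
    (ContMDiffAt.tangentMap_infty (hp _)).mdifferentiableAt (by simp)
  have h1 := mfderiv_comp_apply w
    (hasMFDerivAt_tangentBundle_proj (tangentMap 𝓘(ℝ, E) 𝓘(ℝ, E') p w)).mdifferentiableAt hT X
  have h2 := mfderiv_comp_apply w ((hp w.proj).mdifferentiableAt (by simp))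
    (hasMFDerivAt_tangentBundle_proj w).mdifferentiableAt X
  have h3 := h1.symm.trans h2
  refine Eq.trans ?_ (h3.trans ?_)
  · exact (DFunLike.congr_fun (mfderiv_tangentBundle_proj
      (tangentMap 𝓘(ℝ, E) 𝓘(ℝ, E') p w)) _).symm
  · exact congrArg (modelDeriv E E' p w.proj) (DFunLike.congr_fun (mfderiv_tangentBundle_proj w) X)

/-- On each fibre `Tp` is linear, hence its own derivative. -/
theorem tangentMapDeriv_vertical (hp : ContMDiff 𝓘(ℝ, E) 𝓘(ℝ, E') ∞ p) 
    (w : TangentBundle 𝓘(ℝ, E) M) (b : E) :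
    tangentMapDeriv E E' p w (0, b) = (0, modelDeriv E E' p w.proj b) := by
  obtain ⟨x, a⟩ := w
  suffices H : ∀ a : E, tangentMapDeriv E E' p ⟨x, a⟩ (0, b) = (0, modelDeriv E E' p x b) from H a
  clear a
  intro a
  have hT : MDifferentiableAt 𝓘(ℝ, E).tangent 𝓘(ℝ, E').tangent
      (tangentMap 𝓘(ℝ, E) 𝓘(ℝ, E') p) ⟨x, a⟩ :=
    (ContMDiffAt.tangentMap_infty (hp _)).mdifferentiableAt (by simp)
  have h1 := HasMFDerivAt.comp a hT.hasMFDerivAt (hasMFDerivAt_fibreInclusion x a)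
  have h2 := HasMFDerivAt.comp a
    (hasMFDerivAt_fibreInclusion (p x) (modelDeriv E E' p x a))
    (modelDeriv E E' p x).hasFDerivAt.hasMFDerivAt
  exact DFunLike.congr_fun (hasMFDerivAt_unique h1 h2) b

theorem momentum_contMDiff (m : SmoothMetric E M) (hg : IsOneParameterGroup E g) :
    ContMDiff 𝓘(ℝ, E).tangent 𝓘(ℝ, ℝ) ∞ (momentum m g) := fun w =>
  m.contMDiffAt_inner (b := fun w : TangentBundle 𝓘(ℝ, E) M => w.proj)
    (v := fun w => generator E g w.proj) (w := fun w => w.snd)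
    (ContMDiffAt.comp w (g := fun x => (⟨x, generator E g x⟩ : TangentBundle 𝓘(ℝ, E) M))
      hg.contMDiff_generator.contMDiffAt contMDiff_tangentBundle_proj.contMDiffAt)
    contMDiffAt_id

/-- The derivative of the momentum, as a linear form on the model space. -/
noncomputable def momentumDeriv (m : SmoothMetric E M) (g : ℝ → M → M)
    (w : TangentBundle 𝓘(ℝ, E) M) : E × E →L[ℝ] ℝ :=
  mfderiv 𝓘(ℝ, E).tangent 𝓘(ℝ, ℝ) (momentum m g) w

theorem momentumDeriv_vertical (m : SmoothMetric E M) (hg : IsOneParameterGroup E g)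
    (w : TangentBundle 𝓘(ℝ, E) M) (b : E) :
    momentumDeriv m g w (0, b) = m.bilin w.proj (modelGenerator E g w.proj) b := by
  obtain ⟨x, a⟩ := w
  suffices H : ∀ a : E, momentumDeriv m g ⟨x, a⟩ (0, b) = m.bilin x (modelGenerator E g x) b from
    H a
  clear a
  intro a
  have hT : MDifferentiableAt 𝓘(ℝ, E).tangent 𝓘(ℝ, ℝ) (momentum m g) ⟨x, a⟩ :=
    (momentum_contMDiff m hg _).mdifferentiableAt (by simp)
  have h1 := HasMFDerivAt.comp a hT.hasMFDerivAt (hasMFDerivAt_fibreInclusion x a)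
  have h2 : HasMFDerivAt 𝓘(ℝ, E) 𝓘(ℝ, ℝ) (m.bilin x (modelGenerator E g x)) a _ :=
    (m.bilin x (modelGenerator E g x)).hasFDerivAt.hasMFDerivAt
  exact DFunLike.congr_fun (hasMFDerivAt_unique h1 h2) b

/-- Adding `c • v` to a lift leaves its image unchanged and shifts the momentum by `c ⟨v, v⟩`, with
`⟨v, v⟩ ≠ 0`. -/
theorem exists_mem_level (m : SmoothMetric E M) (hg : IsOneParameterGroup E g)
    (hp : IsPrincipalBundle E E' g p) (k : ℝ) (a : TangentBundle 𝓘(ℝ, E') M') :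
    ∃ w, momentum m g w = k ∧ tangentMap 𝓘(ℝ, E) 𝓘(ℝ, E') p w = a := by
  obtain ⟨u, a⟩ := a
  obtain ⟨x, rfl⟩ := hp.surjective u
  obtain ⟨s, t, h⟩ := hp.exists_isSliceAt hg x
  have hvv := (m.bilin_pos x (hp.generator_ne_zero hg x)).ne'
  let a' : E' := a
  let Y : E := modelDeriv E' E s (p x) a'
  let c : ℝ := (k - m.bilin x (modelGenerator E g x) Y) *
    (m.bilin x (modelGenerator E g x) (modelGenerator E g x))⁻¹
  refine ⟨⟨x, (Y + c • modelGenerator E g x : E)⟩, ?_, ?_⟩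
  · change m.bilin x (modelGenerator E g x) (Y + c • modelGenerator E g x) = k
    rw [map_add, map_smul, smul_eq_mul, inv_mul_cancel_right₀ hvv]
    ring
  · have : modelDeriv E E' p x (Y + c • modelGenerator E g x) = a' := by
      rw [map_add, map_smul, hp.modelDeriv_generator hg, smul_zero, add_zero,
        h.modelDeriv_proj_section_self hp]
    exact congrArg (fun b : E' => (⟨p x, b⟩ : TangentBundle 𝓘(ℝ, E') M')) this

/-- The vertical vector `(0, v)` is killed by the derivative of `Tp`, while `dJ` takes the value
`⟨v, v⟩ ≠ 0` on it. Any lift can therefore be corrected to one tangent to the level. -/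
theorem exists_levelTangent_lift (m : SmoothMetric E M) (hg : IsOneParameterGroup E g)
    (hp : IsPrincipalBundle E E' g p) (w : TangentBundle 𝓘(ℝ, E) M) (Z : E' × E') :
    ∃ X : E × E, momentumDeriv m g w X = 0 ∧ tangentMapDeriv E E' p w X = Z := by
  obtain ⟨A, hA⟩ := hp.modelDeriv_surjective hg w.proj Z.1
  -- The vertical part `B` absorbs the second component already produced by `(A, 0)`.
  obtain ⟨B, hB⟩ := hp.modelDeriv_surjective hg w.proj
    (Z.2 - (tangentMapDeriv E E' p w (A, 0)).2)
  have hvv := (m.bilin_pos w.proj (hp.generator_ne_zero hg w.proj)).ne'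
  let X : E × E := (A, 0) + (0, B)
  let c : ℝ := momentumDeriv m g w X *
    (m.bilin w.proj (modelGenerator E g w.proj) (modelGenerator E g w.proj))⁻¹
  refine ⟨X - c • (0, modelGenerator E g w.proj), ?_, ?_⟩
  · rw [map_sub, map_smul, momentumDeriv_vertical m hg, smul_eq_mul, inv_mul_cancel_right₀ hvv,
      sub_self]
  · rw [map_sub, map_smul, tangentMapDeriv_vertical hp.smooth, hp.modelDeriv_generator hg,
      map_add, tangentMapDeriv_vertical hp.smooth, hB]
    refine Prod.ext ?_ ?_
    · have := tangentMapDeriv_fst hp.smooth w (A, 0)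
      simpa [hA] using this
    · simp

theorem descendsFromLevel_iff {k : ℝ} {n : ℕ}
    {α : DForm 𝓘(ℝ, E).tangent (TangentBundle 𝓘(ℝ, E) M) n}
    {η : DForm 𝓘(ℝ, E').tangent (TangentBundle 𝓘(ℝ, E') M') n} :
    DescendsFromLevel m g p k α η ↔ ∀ w, momentum m g w = k → ∀ X : Fin n → E × E,
      (∀ i, momentumDeriv m g w (X i) = 0) →
      (show (E' × E') [⋀^Fin n]→L[ℝ] ℝ from η (tangentMap 𝓘(ℝ, E) 𝓘(ℝ, E') p w))
        (fun i => tangentMapDeriv E E' p w (X i)) =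
      (show (E × E) [⋀^Fin n]→L[ℝ] ℝ from α w) X := by
  constructor
  · intro h w hw X hX
    exact DFunLike.congr_fun (congrFun h ⟨w, hw⟩) fun i => ⟨X i, hX i⟩
  · intro h
    funext w
    ext X
    exact h w.1 w.2 (fun i => (X i).1) fun i => (X i).2

theorem DescendsFromLevel.unique (hg : IsOneParameterGroup E g)
    (hp : IsPrincipalBundle E E' g p) {k : ℝ} {n : ℕ}
    {α : DForm 𝓘(ℝ, E).tangent (TangentBundle 𝓘(ℝ, E) M) n}
    {η η' : DForm 𝓘(ℝ, E').tangent (TangentBundle 𝓘(ℝ, E') M') n}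
    (h : DescendsFromLevel m g p k α η) (h' : DescendsFromLevel m g p k α η') : η = η' := by
  rw [descendsFromLevel_iff] at h h'
  funext a
  obtain ⟨w, hw, rfl⟩ := exists_mem_level m hg hp k a
  refine ContinuousAlternatingMap.ext fun Z => ?_
  choose X hX hXZ using fun i => exists_levelTangent_lift m hg hp w (Z i)
  have h1 := (h w hw X hX).trans (h' w hw X hX).symm
  rw [show (fun i => tangentMapDeriv E E' p w (X i)) = Z from funext hXZ] at h1
  exact h1

/-- The Lagrange form of `m` in terms of that of the reduced metric and the connection form. -/
theorem lagrangeForm_eq (hg : IsOneParameterGroup E g) (hp : IsPrincipalBundle E E' g p)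
    (h : IsReducedMetric m g p m') :
    lagrangeForm m = ((lagrangeForm m').pullback 𝓘(ℝ, E).tangent (tangentMap 𝓘(ℝ, E) 𝓘(ℝ, E') p) +
      (1 : ℝ) • (fun w => momentum m g w • (connectionForm m g).pullback 𝓘(ℝ, E).tangent
        (fun u : TangentBundle 𝓘(ℝ, E) M => u.proj) w) :
        DForm 𝓘(ℝ, E).tangent (TangentBundle 𝓘(ℝ, E) M) 1) := by
  rw [isReducedMetric_iff hg hp] at h
  funext w
  refine ContinuousAlternatingMap.ext fun X => ?_
  obtain ⟨x, a⟩ := w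
  -- Pointwise the identity is `⟨a, b⟩ = h(a, b) + ⟨v, a⟩ ⟨v, b⟩ / ⟨v, v⟩` with `h` the horizontal
  -- form. The factor `1` fits the shape `η + c • η'` of `DForm.SmoothAt.d_add_smul`.
  have key : ∀ Z : E × E, ∀ a b : E, b = Z.1 → m.bilin x a b =
      m'.bilin (p x) (modelDeriv E E' p x a) (tangentMapDeriv E E' p ⟨x, a⟩ Z).1 +
      1 * (m.bilin x (modelGenerator E g x) a *
        ((m.bilin x (modelGenerator E g x) (modelGenerator E g x))⁻¹ *
          m.bilin x (modelGenerator E g x) b)) := by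
    rintro Z a _ rfl
    rw [tangentMapDeriv_fst hp.smooth, h, m.horizontal_apply]
    ring
  have hproj := DFunLike.congr_fun (mfderiv_tangentBundle_proj (⟨x, a⟩ : TangentBundle 𝓘(ℝ, E) M))
    (X 0)
  have hk := key (X 0) a _ hproj
  refine hk.trans ?_
  refine congrArg₂ (· + ·) (congrArg (m'.bilin (p x) (modelDeriv E E' p x a)) ?_) rfl
  exact (DFunLike.congr_fun (mfderiv_tangentBundle_proj (tangentMap 𝓘(ℝ, E) 𝓘(ℝ, E') p
    (⟨x, a⟩ : TangentBundle 𝓘(ℝ, E) M))) _).symm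

end SecondTangent

/-! ### Products of functions and forms. -/

section SmulForm

variable {F : Type*} [NormedAddCommGroup F] [NormedSpace ℝ F]
  {H : Type*} [TopologicalSpace H] {I : ModelWithCorners ℝ F H} [I.Boundaryless]
  {N : Type*} [TopologicalSpace N] [ChartedSpace H N] [IsManifold I ∞ N]

theorem DForm.SmoothAt.smul {n : ℕ} {β : DForm I N n} {f : N → ℝ} {x : N} (hβ : β.SmoothAt x)
    (hf : ContMDiffAt I 𝓘(ℝ, ℝ) ∞ f x) : DForm.SmoothAt (fun z => f z • β z) x := by
  have hfs : ContMDiffAt 𝓘(ℝ, F) 𝓘(ℝ, ℝ) ∞ (f ∘ (extChartAt I x).symm) (extChartAt I x x) := by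
    refine ContMDiffAt.comp (I' := I) _ ?_
      (contMDiffAt_extChartAt_symm_of_boundaryless (mem_extChartAt_target x))
    rwa [extChartAt_to_inv]
  exact ContDiffAt.smul hfs.contDiffAt hβ

end SmulForm

/-! ### The reduced forms and their symplecticity. -/

section ReducedForms

variable {E E' : Type*} [NormedAddCommGroup E] [NormedSpace ℝ E]
  [NormedAddCommGroup E'] [NormedSpace ℝ E']
  {M : Type*} [TopologicalSpace M] [ChartedSpace E M] [IsManifold 𝓘(ℝ, E) ∞ M]
  {M' : Type*} [TopologicalSpace M'] [ChartedSpace E' M'] [IsManifold 𝓘(ℝ, E') ∞ M']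
  {g : ℝ → M → M} {p : M → M'} {m : SmoothMetric E M} {m' : SmoothMetric E' M'}

theorem lagrangeForm_descends (hg : IsOneParameterGroup E g) (hp : IsPrincipalBundle E E' g p)
    (h : IsReducedMetric m g p m') :
    DescendsFromLevel m g p 0 (lagrangeForm m) (lagrangeForm m') := by
  refine descendsFromLevel_iff.2 fun w hw X _ => ?_
  refine Eq.trans ?_ (DFunLike.congr_fun (congrFun (lagrangeForm_eq hg hp h) w) X).symm
  change _ = _ + (1 : ℝ) * (momentum m g w * _)
  rw [hw, zero_mul, mul_zero, add_zero]
  rfl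

variable [FiniteDimensional ℝ E] [FiniteDimensional ℝ E']

/-- The reduced form at level `k`: the Lagrange form with a magnetic term. -/
noncomputable def magneticForm (m' : SmoothMetric E' M') (K : DForm 𝓘(ℝ, E') M' 2) (k : ℝ) :
    DForm 𝓘(ℝ, E').tangent (TangentBundle 𝓘(ℝ, E') M') 2 :=
  lagrangeTwoForm m' + k • K.pullback 𝓘(ℝ, E').tangent
    (fun u : TangentBundle 𝓘(ℝ, E') M' => u.proj)

/-- Apply `d` to `lagrangeForm_eq`. On vectors annihilated by `dJ` the second term contributes `k
π^* dα = k π^* p^* K`, and `p ∘ π = π ∘ Tp` turns this into a pull-back by `Tp`. -/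
theorem magneticForm_descends (hg : IsOneParameterGroup E g) (hp : IsPrincipalBundle E E' g p)
    (h : IsReducedMetric m g p m') {K : DForm 𝓘(ℝ, E') M' 2}
    (hK : K.pullback 𝓘(ℝ, E) p = (connectionForm m g).d) (k : ℝ) :
    DescendsFromLevel m g p k (lagrangeTwoForm m) (magneticForm m' K k) := by
  refine descendsFromLevel_iff.2 fun w hw X hX => ?_
  have hT : ContMDiffAt 𝓘(ℝ, E).tangent 𝓘(ℝ, E').tangent ∞
    (tangentMap 𝓘(ℝ, E) 𝓘(ℝ, E') p) w := ContMDiffAt.tangentMap_infty (hp.smooth _)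
  have hθ := DForm.isSmooth_iff_smoothAt.1 (lagrangeForm_isSmooth m')
    (tangentMap 𝓘(ℝ, E) 𝓘(ℝ, E') p w)
  have hα := DForm.isSmooth_iff_smoothAt.1 (connectionForm_isSmooth m hg
    (hp.generator_ne_zero hg)) w.proj
  have hπ : ContMDiffAt 𝓘(ℝ, E).tangent 𝓘(ℝ, E) ∞
    (fun u : TangentBundle 𝓘(ℝ, E) M => u.proj) w := contMDiff_tangentBundle_proj w
  have hβ := hα.pullback hπ
  have hJ := momentum_contMDiff m hg w
  have h1 : lagrangeTwoForm m w = (lagrangeTwoForm m').pullback 𝓘(ℝ, E).tangent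
      (tangentMap 𝓘(ℝ, E) 𝓘(ℝ, E') p) w + (1 : ℝ) • DForm.d (fun w => momentum m g w •
        (connectionForm m g).pullback 𝓘(ℝ, E).tangent
        (fun u : TangentBundle 𝓘(ℝ, E) M => u.proj) w) w := by
    rw [lagrangeTwoForm, lagrangeForm_eq hg hp h, (hθ.pullback hT).d_add_smul (hβ.smul hJ),
      DForm.d_pullback hθ hT]
    rfl
  have h2 := DForm.d_smul_apply_of_ker hβ hJ (hX 0) (hX 1)
  rw [DForm.d_pullback hα hπ, ← hK, hw] at h2
  have hXX : (![X 0, X 1] : Fin 2 → E × E) = X := by funext i; fin_cases i <;> rfl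
  refine Eq.trans ?_ (DFunLike.congr_fun h1 X).symm
  change (_ : ℝ) + k * _ = _ + (1 : ℝ) * _
  refine congrArg₂ (fun a b : ℝ => a + b) rfl ?_
  refine Eq.trans ?_ (one_mul _).symm
  refine Eq.trans ?_ (h2.symm.trans (congrArg (fun Y : Fin 2 → E × E =>
    (show (E × E) [⋀^Fin 2]→L[ℝ] ℝ from DForm.d (fun w => momentum m g w •
        (connectionForm m g).pullback 𝓘(ℝ, E).tangent
        (fun u : TangentBundle 𝓘(ℝ, E) M => u.proj) w) w) Y) hXX))
  refine congrArg (k * ·) (DForm.apply_congr K rfl (funext fun i => ?_))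
  have h3 : ∀ Z : E × E, mfderiv 𝓘(ℝ, E').tangent 𝓘(ℝ, E')
      (fun u : TangentBundle 𝓘(ℝ, E') M' => u.proj) (tangentMap 𝓘(ℝ, E) 𝓘(ℝ, E') p w)
      (tangentMapDeriv E E' p w Z) = modelDeriv E E' p w.proj (mfderiv 𝓘(ℝ, E).tangent 𝓘(ℝ, E)
      (fun u : TangentBundle 𝓘(ℝ, E) M => u.proj) w Z) := by
    intro Z
    refine (DFunLike.congr_fun (mfderiv_tangentBundle_proj _) _).trans ?_
    refine (tangentMapDeriv_fst hp.smooth w Z).trans ?_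
    exact congrArg (modelDeriv E E' p w.proj)
      (DFunLike.congr_fun (mfderiv_tangentBundle_proj w) Z).symm
  fin_cases i
  · exact h3 (X 0)
  · exact h3 (X 1)

omit [FiniteDimensional ℝ E'] in
theorem magneticForm_zero (m' : SmoothMetric E' M') (K : DForm 𝓘(ℝ, E') M' 2) :
    magneticForm m' K 0 = lagrangeTwoForm m' := by
  rw [magneticForm, zero_smul, add_zero]

/-- The magnetic term comes from the base, so it vanishes as soon as one argument is vertical. -/
theorem magneticForm_vertical (m' : SmoothMetric E' M') (K : DForm 𝓘(ℝ, E') M' 2) (k : ℝ)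
    (w : TangentBundle 𝓘(ℝ, E') M') (X : E' × E') (b : E') :
    (show (E' × E') [⋀^Fin 2]→L[ℝ] ℝ from magneticForm m' K k w) ![X, (0, b)] =
      - m'.bilin w.proj b X.1 := by
  obtain ⟨u, a⟩ := w
  have h0 : (show (E' × E') [⋀^Fin 2]→L[ℝ] ℝ from K.pullback 𝓘(ℝ, E').tangent
    (fun u : TangentBundle 𝓘(ℝ, E') M' => u.proj) ⟨u, a⟩) ![X, (0, b)] = 0 := by
    refine ContinuousAlternatingMap.map_coord_zero (K u) 1 ?_
    exact DFunLike.congr_fun (mfderiv_tangentBundle_proj (⟨u, a⟩ : TangentBundle 𝓘(ℝ, E') M'))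
      ((0, b) : E' × E')
  refine (congrArg₂ (· + ·) (lagrangeTwoForm_vertical m' u a X b)
    (congrArg (k * ·) h0)).trans ?_
  simp

theorem magneticForm_isSymplectic (m' : SmoothMetric E' M') {K : DForm 𝓘(ℝ, E') M' 2}
    (hK : K.IsSmooth) (hdK : K.d = 0) (k : ℝ) : (magneticForm m' K k).IsSymplectic := by
  have hπ : ContMDiff 𝓘(ℝ, E').tangent 𝓘(ℝ, E') ∞
    (fun u : TangentBundle 𝓘(ℝ, E') M' => u.proj) := contMDiff_tangentBundle_proj
  have hKs := DForm.isSmooth_iff_smoothAt.1 hK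
  have hσ := (lagrangeForm_isSmooth m').d
  have hKπ : (K.pullback 𝓘(ℝ, E').tangent
      (fun u : TangentBundle 𝓘(ℝ, E') M' => u.proj)).IsSmooth :=
    DForm.isSmooth_iff_smoothAt.2 fun w => (hKs _).pullback (hπ w)
  refine ⟨hσ.add_smul hKπ k, funext fun w => ?_, fun w X hX => ?_⟩
  · rw [magneticForm, lagrangeTwoForm, (DForm.isSmooth_iff_smoothAt.1 hσ w).d_add_smul
      (DForm.isSmooth_iff_smoothAt.1 hKπ w), DForm.d_pullback (hKs _) (hπ w),
      (lagrangeForm_isSmooth m').d_d, DForm.pullback, hdK]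
    refine ContinuousAlternatingMap.ext fun Y => ?_
    change (0 : ℝ) + k * 0 = 0
    ring
  · let σ : (E' × E') [⋀^Fin 2]→L[ℝ] ℝ := magneticForm m' K k w
    have key : ∀ X : E' × E', (∀ Y, σ ![X, Y] = 0) → X = 0 := by
      intro X hX
      -- Pairing with the vertical vector `(0, X.1)` gives minus the squared length of `X.1`.
      have h1 : X.1 = 0 := by
        by_contra h1
        have := (magneticForm_vertical m' K k w X X.1).symm.trans (hX (0, X.1))
        exact (m'.bilin_pos w.proj h1).ne' (neg_eq_zero.1 this)
      have h2 : X.2 = 0 := by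
        by_contra h2
        -- Now `X` is itself vertical, so pairing it with `(X.2, 0)` detects `X.2`; antisymmetry
        -- puts the vertical vector in the second slot.
        have hv := magneticForm_vertical m' K k w (X.2, 0) X.2
        have hX' : (0, X.2) = X := Prod.ext h1.symm rfl
        rw [hX'] at hv
        have hs := σ.toAlternatingMap.map_swap ![X, (X.2, 0)] (zero_ne_one (α := Fin 2))
        have hsw : (![X, (X.2, 0)] : Fin 2 → E' × E') ∘ Equiv.swap 0 1 = ![(X.2, 0), X] := by
          funext i; fin_cases i <;> simp
        rw [hsw] at hs
        have h3 : σ ![(X.2, 0), X] = 0 := hs.trans (by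
          rw [neg_eq_zero]; exact hX _)
        exact (m'.bilin_pos w.proj h2).ne' (neg_eq_zero.1 (hv.symm.trans h3))
      exact Prod.ext h1 h2
    exact key X hX

end ReducedForms

end

theorem proposition7
    {E : Type*} [NormedAddCommGroup E] [NormedSpace ℝ E] [FiniteDimensional ℝ E]
    {M : Type*} [TopologicalSpace M] [ChartedSpace E M] [IsManifold 𝓘(ℝ, E) ∞ M]
    {E' : Type*} [NormedAddCommGroup E'] [NormedSpace ℝ E'] [FiniteDimensional ℝ E']
    {M' : Type*} [TopologicalSpace M'] [ChartedSpace E' M'] [IsManifold 𝓘(ℝ, E') ∞ M']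
    (m : SmoothMetric E M) (g : ℝ → M → M) (p : M → M')
    (hg : IsOneParameterGroup E g) (hp : IsPrincipalBundle E E' g p)
    (hm : PreservesMetric m g) :
    (∃! m' : SmoothMetric E' M', IsReducedMetric m g p m') ∧
    (∀ m' : SmoothMetric E' M', IsReducedMetric m g p m' →
      (lagrangeForm m').IsSmooth ∧ (lagrangeTwoForm m').IsSmooth ∧
      (∀ θ' : DForm (𝓘(ℝ, E').tangent) (TangentBundle 𝓘(ℝ, E') M') 1,
        DescendsFromLevel m g p 0 (lagrangeForm m) θ' ↔ θ' = lagrangeForm m') ∧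
      (∀ σ' : DForm (𝓘(ℝ, E').tangent) (TangentBundle 𝓘(ℝ, E') M') 2,
        DescendsFromLevel m g p 0 (lagrangeTwoForm m) σ' ↔ σ' = lagrangeTwoForm m')) ∧
    (∀ k : ℝ, (∃! σ' : DForm (𝓘(ℝ, E').tangent) (TangentBundle 𝓘(ℝ, E') M') 2,
        DescendsFromLevel m g p k (lagrangeTwoForm m) σ') ∧
      ∀ σ' : DForm (𝓘(ℝ, E').tangent) (TangentBundle 𝓘(ℝ, E') M') 2,
        DescendsFromLevel m g p k (lagrangeTwoForm m) σ' → σ'.IsSymplectic) := by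
  obtain ⟨K, hKs, hdK, hK⟩ := exists_curvature hg hp hm (hp.generator_ne_zero hg)
  obtain ⟨m₀, hm₀⟩ := exists_isReducedMetric hg hp hm
  refine ⟨⟨m₀, hm₀, fun m' h => isReducedMetric_unique hg hp h hm₀⟩, fun m' h => ?_, fun k => ?_⟩
  · have hθ := lagrangeForm_descends hg hp h
    -- At level zero the magnetic term disappears, leaving the Lagrange form.
    have hσ := magneticForm_descends hg hp h hK 0
    rw [magneticForm_zero] at hσ
    refine ⟨lagrangeForm_isSmooth m', (lagrangeForm_isSmooth m').d,
      fun θ' => ⟨fun h' => h'.unique hg hp hθ, ?_⟩, fun σ' => ⟨fun h' => h'.unique hg hp hσ, ?_⟩⟩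
    · rintro rfl; exact hθ
    · rintro rfl; exact hσ
  · have hσ := magneticForm_descends hg hp hm₀ hK k
    refine ⟨⟨_, hσ, fun σ' h => h.unique hg hp hσ⟩, fun σ' h => ?_⟩
    rw [h.unique hg hp hσ]
    exact magneticForm_isSymplectic m₀ hKs hdK k
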